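/- Let $p,q\ge 1$ be integers. Let $\mathbb R^{p,q}$ be $\mathbb R^p\times\mathbb R^q$ with the metric $dx_1^2+\cdots+dx_p^2-dy_1^2-\cdots-dy_q^2$, let $\Xi=\{(x,y):|x|=|y|\}\setminus\{0\}$ be its light cone, $\nu(x,y)=|x|=|y|$ on $\Xi$, and $M=\{(x,y):|x|=|y|=1\}=S^{p-1}\times S^{q-1}\subset\Xi$ with the induced pseudo-Riemannian metric $g_M$. The group $O(p,q)=\{h\in GL(p+q,\mathbb R): {}^t h\,I_{p,q}\,h=I_{p,q}\}$, $I_{p,q}=\operatorname{diag}(1,\dots,1,-1,\dots,-1)$, acts linearly on $\Xi$, and on $M\simeq\Xi/\mathbb R_{>0}$ by $L_h z=\Phi(h\cdot z)$, where $\Phi(x,y)=(x/|x|,\,y/|y|)$. Put $$\widetilde\Delta_M=\Bigl(\Delta_{S^{p-1}}-\tfrac14(p-2)^2\Bigr)-\Bigl(\Delta_{S^{q-1}}-\tfrac14(q-2)^2\Bigr),\qquad V^{p,q}=\{f\in C^\infty(M,\mathbb C):\widetilde\Delta_M f=0\},$$ where $\Delta_{S^{n-1}}$ is the Laplace--Beltrami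 operator of the unit sphere. If $p+q\ge4$, i.e. if $n=\dim M=p+q-2\ge2$, then on $C^\infty(M,\mathbb C)$ the operator $\widetilde\Delta_M$ is the Yamabe operator $\Delta_M-\frac{n-2}{4(n-1)}K_M$ of $(M,g_M)$, where $\Delta_M$ is the Laplace--Beltrami operator and $K_M$ the scalar curvature of $g_M$ (normalized so that the unit sphere $S^m$ has scalar curvature $m(m-1)$). Moreover, for all $p,q\ge1$, the formula $$(\varpi^{p,q}(h^{-1})f)(z)=\nu(h\cdot z)^{-\frac{p+q-4}{2}}\,f(L_h z)\qquad(h\in O(p,q),\ f\in V^{p,q},\ z\in M)$$ defines a representation of $O(p,q)$ on $V^{p,q}$: each $\varpi^{p,q}(h)$ is a linear map of $V^{p,q}$ into itself, $\varpi^{p,q}(1)=\mathrm{id}$, and $\varpi^{p,q}(h_1h_2)=\varpi^{p,q}(h_1)\varpi^{p,q}(h_2)$. -/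

import Mathlib

open scoped Manifold ContDiff

noncomputable section

namespace PseudoRiemannian

/-! Pseudo-Riemannian geometry in local coordinates.  `I` is the model of the manifold `M`, with
model vector space `E`, and `b` is a basis of `E`, so that every chart of `M` provides coordinates
indexed by `ι`.  At a point `x` everything is computed in the chart centred at `x`. -/

variable {ι E H M : Type*}
  [NormedAddCommGroup E] [NormedSpace ℝ E] [TopologicalSpace H] (I : ModelWithCorners ℝ E H)
  [TopologicalSpace M] [ChartedSpace H M]

/-- A field of bilinear forms on the tangent spaces of `M`. -/
abbrev MetricField (M : Type*) [TopologicalSpace M] [ChartedSpace H M] : Type _ :=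
  (x : M) → TangentSpace I x → TangentSpace I x → ℝ

/-- The field of bilinear forms induced on `M` by a map `j : M → W` into a vector space that carries
the constant bilinear form `B`. -/
def inducedMetric {W : Type*} [NormedAddCommGroup W] [NormedSpace ℝ W]
    (j : M → W) (B : W → W → ℝ) : MetricField I M :=
  fun x v w => B (mfderiv I 𝓘(ℝ, W) j x v) (mfderiv I 𝓘(ℝ, W) j x w)

/-- The `i`-th partial derivative with respect to the basis `b`. -/
def partialDeriv {V : Type*} [NormedAddCommGroup V] [NormedSpace ℝ V]
    (b : Module.Basis ι ℝ E) (i : ι) (F : E → V) (u : E) : V :=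
  fderiv ℝ F u (b i)

/-- The components `g_{ij}` of the metric in the chart at `x`, as functions of the coordinates. -/
def metricMatrix (b : Module.Basis ι ℝ E) (g : MetricField I M) (x : M) (u : E) : Matrix ι ι ℝ :=
  Matrix.of fun i j => g ((extChartAt I x).symm u)
    (mfderiv 𝓘(ℝ, E) I (extChartAt I x).symm u (b i))
    (mfderiv 𝓘(ℝ, E) I (extChartAt I x).symm u (b j))

lemma contDiffAt_partialDeriv (b : Module.Basis ι ℝ E) (i : ι) {F : E → ℂ} {u : E}
    (hF : ContDiffAt ℝ ∞ F u) : ContDiffAt ℝ ∞ (partialDeriv b i F) u :=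
  (hF.fderiv_right (m := ∞) (by simp)).clm_apply contDiffAt_const

lemma partialDeriv_add (b : Module.Basis ι ℝ E) (i : ι) {F G : E → ℂ} {u : E}
    (hF : ContDiffAt ℝ ∞ F u) (hG : ContDiffAt ℝ ∞ G u) :
    partialDeriv b i (F + G) u = partialDeriv b i F u + partialDeriv b i G u := by
  simp only [partialDeriv]
  rw [fderiv_add (hF.differentiableAt (by simp)) (hG.differentiableAt (by simp))]
  rfl

lemma partialDeriv_partialDeriv_add (b : Module.Basis ι ℝ E) (i j : ι) {F G : E → ℂ} {u : E}
    (hF : ContDiffAt ℝ ∞ F u) (hG : ContDiffAt ℝ ∞ G u) :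
    partialDeriv b i (partialDeriv b j (F + G)) u
      = partialDeriv b i (partialDeriv b j F) u + partialDeriv b i (partialDeriv b j G) u := by
  rw [← partialDeriv_add b i (contDiffAt_partialDeriv b j hF) (contDiffAt_partialDeriv b j hG)]
  have h : partialDeriv b j (F + G) =ᶠ[nhds u] partialDeriv b j F + partialDeriv b j G := by
    have hF' := (hF.of_le (m := 1) (by simp)).eventually (by simp)
    have hG' := (hG.of_le (m := 1) (by simp)).eventually (by simp)
    filter_upwards [hF', hG'] with v h1 h2
    simp only [partialDeriv, Pi.add_apply]
    rw [fderiv_add (h1.differentiableAt (by simp)) (h2.differentiableAt (by simp))]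
    rfl
  simp only [partialDeriv] at h ⊢
  rw [h.fderiv_eq]

lemma partialDeriv_smul (b : Module.Basis ι ℝ E) (i : ι) (c : ℂ) (F : E → ℂ) :
    partialDeriv b i (c • F) = c • partialDeriv b i F := by
  funext u
  simp only [partialDeriv, Pi.smul_apply]
  rw [fderiv_const_smul_field]
  rfl

variable [Fintype ι] [DecidableEq ι]

/-- The Christoffel symbol `Γ^k_{ij}` of the Levi-Civita connection of the metric with
components `G`. -/
def christoffel (b : Module.Basis ι ℝ E) (G : E → Matrix ι ι ℝ) (k i j : ι) (u : E) : ℝ :=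
  (1 / 2) * ∑ l, (G u)⁻¹ k l *
    (partialDeriv b i (fun v => G v j l) u + partialDeriv b j (fun v => G v i l) u
      - partialDeriv b l (fun v => G v i j) u)

/-- The Ricci tensor
`R_{jk} = ∂_i Γ^i_{jk} - ∂_j Γ^i_{ik} + Γ^i_{il} Γ^l_{jk} - Γ^i_{jl} Γ^l_{ik}`. -/
def ricci (b : Module.Basis ι ℝ E) (G : E → Matrix ι ι ℝ) (j k : ι) (u : E) : ℝ :=
  ∑ i, (partialDeriv b i (christoffel b G i j k) u - partialDeriv b j (christoffel b G i i k) u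
    + ∑ l, (christoffel b G i i l u * christoffel b G l j k u
      - christoffel b G i j l u * christoffel b G l i k u))

/-- The scalar curvature `K_M(x) = g^{jk} R_{jk}`; it is `n(n-1)` on the unit sphere `S^n`. -/
def scalarCurvature (b : Module.Basis ι ℝ E) (g : MetricField I M) (x : M) : ℝ :=
  ∑ j, ∑ k, (metricMatrix I b g x (extChartAt I x x))⁻¹ j k *
    ricci b (metricMatrix I b g x) j k (extChartAt I x x)

/-- The Laplace-Beltrami operator
`Δ_M f = g^{ij} (∂_i ∂_j f - Γ^k_{ij} ∂_k f)` (trace of the Hessian). -/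
def laplaceBeltrami (b : Module.Basis ι ℝ E) (g : MetricField I M) (f : M → ℂ) (x : M) : ℂ :=
  ∑ i, ∑ j, (metricMatrix I b g x (extChartAt I x x))⁻¹ i j •
    (partialDeriv b i (partialDeriv b j (f ∘ (extChartAt I x).symm)) (extChartAt I x x)
      - ∑ k, christoffel b (metricMatrix I b g x) k i j (extChartAt I x x) •
          partialDeriv b k (f ∘ (extChartAt I x).symm) (extChartAt I x x))

/-- The Yamabe operator `Δ_M - (n-2)/(4(n-1)) K_M` of a pseudo-Riemannian manifold of dimension
`n ≥ 2`. -/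
def yamabe (b : Module.Basis ι ℝ E) (g : MetricField I M) (f : M → ℂ) (x : M) : ℂ :=
  laplaceBeltrami I b g f x
    - ((((Fintype.card ι : ℝ) - 2) / (4 * ((Fintype.card ι : ℝ) - 1))
        * scalarCurvature I b g x : ℝ) : ℂ) * f x

section Linearity

lemma contDiffAt_coord [I.Boundaryless] {f : M → ℂ} (hf : ContMDiff I 𝓘(ℝ, ℂ) ∞ f) (x : M) :
    ContDiffAt ℝ ∞ (f ∘ (extChartAt I x).symm) (extChartAt I x x) := by
  have h := ((contMDiffAt_iff (x := x)).1 (hf x)).2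
  rw [I.range_eq_univ, contDiffWithinAt_univ] at h
  exact h

lemma laplaceBeltrami_add [I.Boundaryless] (b : Module.Basis ι ℝ E) (g : MetricField I M)
    {f₁ f₂ : M → ℂ} (h₁ : ContMDiff I 𝓘(ℝ, ℂ) ∞ f₁) (h₂ : ContMDiff I 𝓘(ℝ, ℂ) ∞ f₂) (x : M) :
    laplaceBeltrami I b g (f₁ + f₂) x
      = laplaceBeltrami I b g f₁ x + laplaceBeltrami I b g f₂ x := by
  have k₁ := contDiffAt_coord I h₁ x
  have k₂ := contDiffAt_coord I h₂ x
  have e : (f₁ + f₂) ∘ (extChartAt I x).symm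
      = f₁ ∘ (extChartAt I x).symm + f₂ ∘ (extChartAt I x).symm := rfl
  simp only [laplaceBeltrami, e, partialDeriv_add b _ k₁ k₂, partialDeriv_partialDeriv_add b _ _ k₁ k₂,
    ← Finset.sum_add_distrib]
  refine Finset.sum_congr rfl fun i _ => Finset.sum_congr rfl fun j _ => ?_
  refine (congrArg _ ?_).trans (smul_add _ _ _)
  simp only [smul_add, Finset.sum_add_distrib]
  ring

lemma laplaceBeltrami_smul (b : Module.Basis ι ℝ E) (g : MetricField I M)
    (c : ℂ) (f : M → ℂ) (x : M) :
    laplaceBeltrami I b g (c • f) x = c * laplaceBeltrami I b g f x := by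
  have e : (c • f) ∘ (extChartAt I x).symm = c • (f ∘ (extChartAt I x).symm) := rfl
  simp only [laplaceBeltrami, e, partialDeriv_smul, Pi.smul_apply, smul_eq_mul, Complex.real_smul,
    Finset.mul_sum, mul_sub]
  refine Finset.sum_congr rfl fun i _ => Finset.sum_congr rfl fun j _ => ?_
  congr 1
  · ring
  · refine Finset.sum_congr rfl fun k _ => ?_
    ring

end Linearity

end PseudoRiemannian

namespace IndefiniteOrthogonal

/-- `ℝⁿ` with its Euclidean norm. -/
abbrev Euc (n : ℕ) : Type := EuclideanSpace ℝ (Fin n)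

/-- The unit sphere `S^{n-1}` in `ℝⁿ`, for `n ≥ 1`. -/
abbrev Sph (n : ℕ) : Type := Metric.sphere (0 : Euc n) 1

instance finrankFact (n : ℕ) [NeZero n] : Fact (Module.finrank ℝ (Euc n) = (n - 1) + 1) :=
  ⟨by rw [finrank_euclideanSpace_fin, Nat.sub_add_cancel (Nat.one_le_iff_ne_zero.2 (NeZero.ne n))]⟩

/-- The model of the manifold `S^{p-1} × S^{q-1}`. -/
abbrev model (p q : ℕ) := (𝓡 (p - 1)).prod (𝓡 (q - 1))

/-- The standard basis of `ℝᵐ`. -/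
abbrev stdBasis (m : ℕ) : Module.Basis (Fin m) ℝ (Euc m) := (EuclideanSpace.basisFun (Fin m) ℝ).toBasis

/-- The bilinear form of `dx_1² + ⋯ + dx_p² - dy_1² - ⋯ - dy_q²`. -/
def form {p q : ℕ} (v w : Euc p × Euc q) : ℝ := inner ℝ v.1 w.1 - inner ℝ v.2 w.2

/-- The standard Riemannian metric of the unit sphere. -/
def sphereMetric (n : ℕ) [NeZero n] : PseudoRiemannian.MetricField (𝓡 (n - 1)) (Sph n) :=
  PseudoRiemannian.inducedMetric (𝓡 (n - 1)) (fun x : Sph n => (x : Euc n))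
    (fun v w => inner ℝ v w)

/-- The pseudo-Riemannian metric that `ℝ^{p,q}` induces on `M = S^{p-1} × S^{q-1}`. -/
def productMetric (p q : ℕ) [NeZero p] [NeZero q] :
    PseudoRiemannian.MetricField (model p q) (Sph p × Sph q) :=
  PseudoRiemannian.inducedMetric (model p q)
    (fun z : Sph p × Sph q => ((z.1 : Euc p), (z.2 : Euc q))) form

/-- The Laplace-Beltrami operator of the unit sphere `S^{n-1}`. -/
def sphereLaplacian (n : ℕ) [NeZero n] (f : Sph n → ℂ) (x : Sph n) : ℂ :=
  PseudoRiemannian.laplaceBeltrami (𝓡 (n - 1)) (stdBasis (n - 1)) (sphereMetric n) f x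

/-- The operator
`(Δ_{S^{p-1}} - (p-2)²/4) - (Δ_{S^{q-1}} - (q-2)²/4)` on functions on `S^{p-1} × S^{q-1}`. -/
def yamabeOp (p q : ℕ) [NeZero p] [NeZero q] (f : Sph p × Sph q → ℂ) (z : Sph p × Sph q) : ℂ :=
  (sphereLaplacian p (fun x => f (x, z.2)) z.1 - (1 / 4) * ((p : ℂ) - 2) ^ 2 * f z)
    - (sphereLaplacian q (fun y => f (z.1, y)) z.2 - (1 / 4) * ((q : ℂ) - 2) ^ 2 * f z)

/-- The Yamabe operator of the pseudo-Riemannian manifold `S^{p-1} × S^{q-1}`, defined through its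
Laplace-Beltrami operator and its scalar curvature. -/
def intrinsicYamabe (p q : ℕ) [NeZero p] [NeZero q] (f : Sph p × Sph q → ℂ) :
    Sph p × Sph q → ℂ :=
  PseudoRiemannian.yamabe (model p q) ((stdBasis (p - 1)).prod (stdBasis (q - 1)))
    (productMetric p q) f

/-- `f` is a smooth complex-valued function on `S^{p-1} × S^{q-1}`. -/
def IsSmooth {p q : ℕ} [NeZero p] [NeZero q] (f : Sph p × Sph q → ℂ) : Prop :=
  ContMDiff (model p q) 𝓘(ℝ, ℂ) ∞ f

lemma IsSmooth.fst {p q : ℕ} [NeZero p] [NeZero q] {f : Sph p × Sph q → ℂ} (hf : IsSmooth f)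
    (y : Sph q) : ContMDiff (𝓡 (p - 1)) 𝓘(ℝ, ℂ) ∞ (fun x => f (x, y)) :=
  ContMDiff.comp (I' := model p q) hf (contMDiff_id.prodMk contMDiff_const)

lemma IsSmooth.snd {p q : ℕ} [NeZero p] [NeZero q] {f : Sph p × Sph q → ℂ} (hf : IsSmooth f)
    (x : Sph p) : ContMDiff (𝓡 (q - 1)) 𝓘(ℝ, ℂ) ∞ (fun y => f (x, y)) :=
  ContMDiff.comp (I' := model p q) hf (contMDiff_const.prodMk contMDiff_id)

/-- The space `V^{p,q}` of smooth solutions of the Yamabe equation on `S^{p-1} × S^{q-1}`. -/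
def V (p q : ℕ) [NeZero p] [NeZero q] : Submodule ℂ (Sph p × Sph q → ℂ) where
  carrier := {f | IsSmooth f ∧ ∀ z, yamabeOp p q f z = 0}
  zero_mem' := by
    refine ⟨contMDiff_const, fun z => ?_⟩
    have h (n : ℕ) [NeZero n] (x : Sph n) : sphereLaplacian n (fun _ => (0 : ℂ)) x = 0 := by
      have := PseudoRiemannian.laplaceBeltrami_smul (𝓡 (n - 1)) (stdBasis (n - 1))
        (sphereMetric n) 0 (fun _ => (0 : ℂ)) x
      rw [zero_mul, zero_smul] at this
      exact this
    simp [yamabeOp, h]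
  add_mem' := by
    rintro f g ⟨hf, hf0⟩ ⟨hg, hg0⟩
    refine ⟨ContMDiff.add hf hg, fun z => ?_⟩
    have h1 : sphereLaplacian p (fun x => (f + g) (x, z.2)) z.1
        = sphereLaplacian p (fun x => f (x, z.2)) z.1
          + sphereLaplacian p (fun x => g (x, z.2)) z.1 :=
      PseudoRiemannian.laplaceBeltrami_add _ _ _ (hf.fst z.2) (hg.fst z.2) z.1
    have h2 : sphereLaplacian q (fun y => (f + g) (z.1, y)) z.2
        = sphereLaplacian q (fun y => f (z.1, y)) z.2
          + sphereLaplacian q (fun y => g (z.1, y)) z.2 :=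
      PseudoRiemannian.laplaceBeltrami_add _ _ _ (hf.snd z.1) (hg.snd z.1) z.2
    have e1 := hf0 z
    have e2 := hg0 z
    simp only [yamabeOp] at e1 e2 ⊢
    rw [h1, h2, Pi.add_apply]
    linear_combination e1 + e2
  smul_mem' := by
    rintro c f ⟨hf, hf0⟩
    refine ⟨ContMDiff.comp (I' := 𝓘(ℝ, ℂ)) (g := fun w : ℂ => c * w)
      (ContDiff.contMDiff (contDiff_const.mul contDiff_id)) hf, fun z => ?_⟩
    have h1 : sphereLaplacian p (fun x => (c • f) (x, z.2)) z.1
        = c * sphereLaplacian p (fun x => f (x, z.2)) z.1 :=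
      PseudoRiemannian.laplaceBeltrami_smul _ _ _ c (fun x => f (x, z.2)) z.1
    have h2 : sphereLaplacian q (fun y => (c • f) (z.1, y)) z.2
        = c * sphereLaplacian q (fun y => f (z.1, y)) z.2 :=
      PseudoRiemannian.laplaceBeltrami_smul _ _ _ c (fun y => f (z.1, y)) z.2
    have e1 := hf0 z
    simp only [yamabeOp] at e1 ⊢
    rw [h1, h2, Pi.smul_apply, smul_eq_mul]
    linear_combination c * e1

/-- The matrix `I_{p,q} = diag(1, …, 1, -1, …, -1)`. -/
def Ipq (p q : ℕ) : Matrix (Fin p ⊕ Fin q) (Fin p ⊕ Fin q) ℝ :=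
  Matrix.diagonal (Sum.elim (fun _ => 1) (fun _ => -1))

/-- The indefinite orthogonal group `O(p,q)`, the matrices `g` with `ᵗg I_{p,q} g = I_{p,q}`. -/
def O (p q : ℕ) : Subgroup (GL (Fin p ⊕ Fin q) ℝ) where
  carrier := {g | (g : Matrix (Fin p ⊕ Fin q) (Fin p ⊕ Fin q) ℝ).transpose * Ipq p q
    * (g : Matrix (Fin p ⊕ Fin q) (Fin p ⊕ Fin q) ℝ) = Ipq p q}
  one_mem' := by simp
  mul_mem' := by
    intro a b ha hb
    simp only [Set.mem_ofPred_eq] at ha hb ⊢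
    rw [Units.val_mul, Matrix.transpose_mul]
    calc _ = (b : Matrix (Fin p ⊕ Fin q) (Fin p ⊕ Fin q) ℝ).transpose
          * ((a : Matrix (Fin p ⊕ Fin q) (Fin p ⊕ Fin q) ℝ).transpose * Ipq p q
            * (a : Matrix (Fin p ⊕ Fin q) (Fin p ⊕ Fin q) ℝ))
          * (b : Matrix (Fin p ⊕ Fin q) (Fin p ⊕ Fin q) ℝ) := by simp only [Matrix.mul_assoc]
      _ = _ := by rw [ha, hb]
  inv_mem' := by
    intro a ha
    simp only [Set.mem_ofPred_eq] at ha ⊢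
    have h1 : (a : Matrix (Fin p ⊕ Fin q) (Fin p ⊕ Fin q) ℝ)
        * ((a⁻¹ : GL (Fin p ⊕ Fin q) ℝ) : Matrix (Fin p ⊕ Fin q) (Fin p ⊕ Fin q) ℝ) = 1 :=
      Units.mul_inv a
    have h2 := congrArg Matrix.transpose h1
    rw [Matrix.transpose_mul, Matrix.transpose_one] at h2
    conv_lhs => rw [← ha]
    calc _ = (((a⁻¹ : GL (Fin p ⊕ Fin q) ℝ) :
            Matrix (Fin p ⊕ Fin q) (Fin p ⊕ Fin q) ℝ).transpose
            * (a : Matrix (Fin p ⊕ Fin q) (Fin p ⊕ Fin q) ℝ).transpose) * Ipq p q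
          * ((a : Matrix (Fin p ⊕ Fin q) (Fin p ⊕ Fin q) ℝ)
            * ((a⁻¹ : GL (Fin p ⊕ Fin q) ℝ) : Matrix (Fin p ⊕ Fin q) (Fin p ⊕ Fin q) ℝ)) := by
          simp only [Matrix.mul_assoc]
      _ = _ := by rw [h1, h2, Matrix.one_mul, Matrix.mul_one]

/-- The natural action of a matrix on `ℝ^{p,q}`, whose points are pairs `(x, y)`. -/
def act {p q : ℕ} (h : O p q) (z : Euc p × Euc q) : Euc p × Euc q :=
  (WithLp.toLp 2 fun i => (((h : GL (Fin p ⊕ Fin q) ℝ) :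
      Matrix (Fin p ⊕ Fin q) (Fin p ⊕ Fin q) ℝ).mulVec (Sum.elim z.1 z.2)) (Sum.inl i),
   WithLp.toLp 2 fun j => (((h : GL (Fin p ⊕ Fin q) ℝ) :
      Matrix (Fin p ⊕ Fin q) (Fin p ⊕ Fin q) ℝ).mulVec (Sum.elim z.1 z.2)) (Sum.inr j))

/-- The light cone `Ξ = {(x, y) : |x| = |y|} \ {0}`. -/
def cone (p q : ℕ) : Set (Euc p × Euc q) := {z | ‖z.1‖ = ‖z.2‖} \ {0}

/-- The function `ν(x, y) = |x| = |y|` on the light cone. -/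
def nu {p q : ℕ} (ξ : cone p q) : ℝ := ‖ξ.1.1‖

lemma nu_pos {p q : ℕ} (ξ : cone p q) : 0 < ‖ξ.1.1‖ ∧ 0 < ‖ξ.1.2‖ := by
  obtain ⟨⟨x, y⟩, h, h0⟩ := ξ
  have h' : ‖x‖ = ‖y‖ := h
  have hx : x ≠ 0 := by
    rintro rfl
    rw [norm_zero, eq_comm, norm_eq_zero] at h'
    subst h'
    exact h0 rfl
  exact ⟨norm_pos_iff.2 hx, h' ▸ norm_pos_iff.2 hx⟩

/-- The projection `Φ(x, y) = (x / |x|, y / |y|)` from the light cone to `M`, which identifies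
`Ξ / ℝ_{>0}` with `M`. -/
def Phi {p q : ℕ} (ξ : cone p q) : Sph p × Sph q :=
  (⟨‖ξ.1.1‖⁻¹ • ξ.1.1, by
      rw [mem_sphere_zero_iff_norm, norm_smul, norm_inv, norm_norm,
        inv_mul_cancel₀ (nu_pos ξ).1.ne']⟩,
   ⟨‖ξ.1.2‖⁻¹ • ξ.1.2, by
      rw [mem_sphere_zero_iff_norm, norm_smul, norm_inv, norm_norm,
        inv_mul_cancel₀ (nu_pos ξ).2.ne']⟩)

/-- The inclusion of `M = {|x| = |y| = 1}` into the light cone. -/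
def incl {p q : ℕ} (z : Sph p × Sph q) : cone p q :=
  ⟨(z.1, z.2), by
    have h1 : ‖(z.1 : Euc p)‖ = 1 := mem_sphere_zero_iff_norm.1 z.1.2
    have h2 : ‖(z.2 : Euc q)‖ = 1 := mem_sphere_zero_iff_norm.1 z.2.2
    refine ⟨h1.trans h2.symm, fun h => ?_⟩
    have h3 : (z.1 : Euc p) = 0 := congrArg Prod.fst h
    rw [h3, norm_zero] at h1
    exact zero_ne_one h1⟩

lemma dotProduct_Ipq {p q : ℕ} (z : Euc p × Euc q) :
    (Sum.elim z.1 z.2 : Fin p ⊕ Fin q → ℝ) ⬝ᵥ (Ipq p q).mulVec (Sum.elim z.1 z.2)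
      = ‖z.1‖ ^ 2 - ‖z.2‖ ^ 2 := by
  rw [EuclideanSpace.real_norm_sq_eq, EuclideanSpace.real_norm_sq_eq]
  simp [dotProduct, Ipq, Matrix.mulVec_diagonal, Fintype.sum_sum_type, sq, sub_eq_add_neg]

lemma elim_act {p q : ℕ} (h : O p q) (z : Euc p × Euc q) :
    (Sum.elim (act h z).1 (act h z).2 : Fin p ⊕ Fin q → ℝ)
      = ((h : GL (Fin p ⊕ Fin q) ℝ) :
        Matrix (Fin p ⊕ Fin q) (Fin p ⊕ Fin q) ℝ).mulVec (Sum.elim z.1 z.2) := by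
  funext k
  cases k <;> rfl

lemma act_mem_cone {p q : ℕ} (h : O p q) (ξ : cone p q) : act h ξ.1 ∈ cone p q := by
  obtain ⟨z, hz, hz0⟩ := ξ
  have hz' : ‖z.1‖ = ‖z.2‖ := hz
  have key : ‖(act h z).1‖ ^ 2 - ‖(act h z).2‖ ^ 2 = ‖z.1‖ ^ 2 - ‖z.2‖ ^ 2 := by
    rw [← dotProduct_Ipq, ← dotProduct_Ipq, elim_act, Matrix.mulVec_mulVec,
      ← Matrix.vecMul_transpose, ← Matrix.dotProduct_mulVec, Matrix.mulVec_mulVec,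
      ← Matrix.mul_assoc]
    rw [show _ = Ipq p q from h.2]
  refine ⟨?_, fun h0 => ?_⟩
  · rw [hz', sub_self, sub_eq_zero] at key
    exact (sq_eq_sq₀ (norm_nonneg _) (norm_nonneg _)).1 key
  · have h0' : act h z = 0 := h0
    have e := elim_act h z
    rw [h0'] at e
    have e' := congrArg (((h : GL (Fin p ⊕ Fin q) ℝ)⁻¹ : GL (Fin p ⊕ Fin q) ℝ) :
      Matrix (Fin p ⊕ Fin q) (Fin p ⊕ Fin q) ℝ).mulVec e
    rw [Matrix.mulVec_mulVec, Units.inv_mul, Matrix.one_mulVec] at e'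
    have e0 : (Sum.elim (0 : Euc p × Euc q).1 (0 : Euc p × Euc q).2 : Fin p ⊕ Fin q → ℝ) = 0 := by
      funext k
      cases k <;> rfl
    rw [e0, Matrix.mulVec_zero] at e'
    apply hz0
    refine Prod.ext ?_ ?_
    · ext i
      exact (congrFun e' (Sum.inl i)).symm
    · ext j
      exact (congrFun e' (Sum.inr j)).symm

/-- The action of `O(p,q)` on the light cone. -/
def actCone {p q : ℕ} (h : O p q) (ξ : cone p q) : cone p q := ⟨act h ξ.1, act_mem_cone h ξ⟩

/-- The action `L_h` of `h ∈ O(p,q)` on `M ≃ Ξ / ℝ_{>0}`. -/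
def L {p q : ℕ} (h : O p q) (z : Sph p × Sph q) : Sph p × Sph q := Phi (actCone h (incl z))

end IndefiniteOrthogonal

end

/-!
Identify a function on `S^{p-1} × S^{q-1}` with its homogeneous extension of degree `-(p+q-4)/2` to
the light cone and a neighbourhood of it. By Euler's relations the ultrahyperbolic operator
`∑ ∂²/∂xᵢ² - ∑ ∂²/∂yⱼ²` restricts on such extensions to the Yamabe operator. It commutes with
`O(p,q)` and lowers the degree of homogeneity by two, so the space of solutions is preserved by the
linear action on extensions, which read on `S^{p-1} × S^{q-1}` is `ϖ^{p,q}`.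

The operator is intrinsic because in stereographic coordinates centred at a point the product metric
is diagonal with vanishing first derivatives at that point: there the Laplace-Beltrami operator is
the signed sum of pure second derivatives, and the scalar curvature is read off from the second
derivatives of the conformal factors.
-/

noncomputable section

section SecondDerivative

variable {E W Z : Type*} [NormedAddCommGroup E] [NormedSpace ℝ E] [NormedAddCommGroup W]
  [NormedSpace ℝ W] [NormedAddCommGroup Z] [NormedSpace ℝ Z]

lemma fderiv_fderiv_apply {F : E → Z} {u : E} (hF : ContDiffAt ℝ 2 F u) (v w : E) :
    fderiv ℝ (fun x => fderiv ℝ F x w) u v = fderiv ℝ (fderiv ℝ F) u v w := by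
  rw [fderiv_clm_apply ((hF.fderiv_right (m := 1) le_rfl).differentiableAt one_ne_zero)
    (differentiableAt_const w)]
  simp

lemma fderiv_fderiv_comp {F : W → Z} {σ : E → W} {u : E} (hF : ContDiffAt ℝ 2 F (σ u))
    (hσ : ContDiffAt ℝ 2 σ u) (v w : E) :
    fderiv ℝ (fderiv ℝ (F ∘ σ)) u v w
      = fderiv ℝ (fderiv ℝ F) (σ u) (fderiv ℝ σ u v) (fderiv ℝ σ u w)
        + fderiv ℝ F (σ u) (fderiv ℝ (fderiv ℝ σ) u v w) := by
  have hF₁ : DifferentiableAt ℝ (fderiv ℝ F) (σ u) :=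
    (hF.fderiv_right (m := 1) le_rfl).differentiableAt one_ne_zero
  have hσ₁ : DifferentiableAt ℝ (fderiv ℝ σ) u :=
    (hσ.fderiv_right (m := 1) le_rfl).differentiableAt one_ne_zero
  have chain_rule :
      fderiv ℝ (F ∘ σ) =ᶠ[nhds u] fun x => (fderiv ℝ F (σ x)).comp (fderiv ℝ σ x) := by
    filter_upwards [hσ.eventually (by simp), hσ.continuousAt.eventually (hF.eventually (by simp))]
      with x hx hFx
    exact fderiv_comp x (hFx.differentiableAt two_ne_zero) (hx.differentiableAt two_ne_zero)
  have h := (hF₁.hasFDerivAt.comp u (hσ.differentiableAt two_ne_zero).hasFDerivAt).clm_comp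
    hσ₁.hasFDerivAt
  have h' := DFunLike.congr_fun (DFunLike.congr_fun (chain_rule.fderiv_eq.trans h.fderiv) v) w
  simpa [add_comm] using h'

lemma fderiv_fderiv_comp_affine {F : W → Z} (T : E →L[ℝ] W) (c : W) {u : E}
    (hF : ContDiffAt ℝ 2 F (T u + c)) (v w : E) :
    fderiv ℝ (fderiv ℝ fun x => F (T x + c)) u v w
      = fderiv ℝ (fderiv ℝ F) (T u + c) (T v) (T w) := by
  have hT (x : E) : fderiv ℝ (fun x => T x + c) x = T := (T.hasFDerivAt.add_const c).fderiv
  have h := fderiv_fderiv_comp hF (σ := fun x => T x + c)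
    (T.contDiff.add contDiff_const).contDiffAt v w
  simp only [funext hT, fderiv_fun_const, Pi.zero_apply, zero_apply, map_zero, add_zero] at h
  exact h

lemma hasFDerivAt_smul_of_eq_zero {f : E → ℝ} {g : E → Z} {g' : E →L[ℝ] Z} {u : E}
    (hf : ContinuousAt f u) (hg : HasFDerivAt g g' u) (hgu : g u = 0) :
    HasFDerivAt (fun x => f x • g x) (f u • g') u := by
  have hremainder : (fun x => f u • (g x - g u - g' (x - u))) =o[nhds u] fun x => x - u :=
    hg.isLittleO.const_smul_left _
  have hvariation : (fun x => (f x - f u) • (g x - g u)) =o[nhds u] fun x => x - u := by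
    simpa using ((Asymptotics.isLittleO_one_iff ℝ).2
      (tendsto_sub_nhds_zero_iff.2 hf)).smul_isBigO hg.isBigO_sub
  refine .of_isLittleO ((hremainder.add hvariation).congr_left fun x => ?_)
  simp only [hgu, smul_apply]
  module

end SecondDerivative

section Trace

variable {E Z : Type*} [NormedAddCommGroup E] [NormedAddCommGroup Z] [NormedSpace ℝ Z]

lemma sum_bilin_orthonormalBasis [InnerProductSpace ℝ E] [FiniteDimensional ℝ E] {ι κ : Type*}
    [Fintype ι] [Fintype κ] (v : OrthonormalBasis ι ℝ E) (w : OrthonormalBasis κ ℝ E)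
    (B : E →L[ℝ] E →L[ℝ] Z) : ∑ i, B (v i) (v i) = ∑ j, B (w j) (w j) := by
  have h := congrArg (TensorProduct.lift B.toLinearMap₁₂)
    ((InnerProductSpace.canonicalCovariantTensor_eq_sum E v).symm.trans
      (InnerProductSpace.canonicalCovariantTensor_eq_sum E w))
  simpa using h

variable [NormedSpace ℝ E]

lemma sum_smul_bilin_sum {ι κ : Type*} [Fintype ι] [Fintype κ] [DecidableEq κ]
    (A : Matrix ι κ ℝ) (s : κ → ℝ) (v : ι → E) (B : E →L[ℝ] E →L[ℝ] Z) :
    ∑ k, s k • B (∑ i, A i k • v i) (∑ j, A j k • v j)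
      = ∑ i, ∑ j, (A * Matrix.diagonal s * A.transpose) i j • B (v i) (v j) := by
  have hentry (i j : ι) : (A * Matrix.diagonal s * A.transpose) i j
      = ∑ k, s k * (A i k * A j k) := by
    simp only [Matrix.mul_apply (N := A.transpose), Matrix.mul_diagonal, Matrix.transpose_apply]
    exact Finset.sum_congr rfl fun k _ => by ring
  simp only [hentry, map_sum, map_smul, sum_apply, smul_apply, Finset.sum_smul, Finset.smul_sum,
    smul_smul]
  rw [Finset.sum_comm_cycle]
  refine Finset.sum_congr rfl fun i _ => Finset.sum_comm.trans ?_
  exact Finset.sum_congr rfl fun j _ => Finset.sum_congr rfl fun k _ => by rw [mul_comm (A j k)]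

end Trace

section Homogeneous

variable {E Z : Type*} [NormedAddCommGroup E] [NormedSpace ℝ E] [NormedAddCommGroup Z]
  [NormedSpace ℝ Z]

/-- `F` is positively homogeneous of degree `lam`. -/
def IsPosHomogeneous (lam : ℝ) (F : E → Z) : Prop :=
  ∀ ⦃t : ℝ⦄, 0 < t → ∀ ξ, F (t • ξ) = t ^ lam • F ξ

variable {F : E → Z} {lam : ℝ}

lemma IsPosHomogeneous.fderiv_right (hF : IsPosHomogeneous lam F) :
    IsPosHomogeneous (lam - 1) (fderiv ℝ F) := by
  intro t ht ξ
  have h : t • fderiv ℝ F (t • ξ) = t ^ lam • fderiv ℝ F ξ := by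
    rw [← fderiv_comp_smul, funext (hF ht)]
    exact congrFun (fderiv_const_smul_field (t ^ lam)) ξ
  rw [Real.rpow_sub_one ht.ne', div_eq_inv_mul, mul_smul, ← h, inv_smul_smul₀ ht.ne']

lemma IsPosHomogeneous.fderiv_apply_self (hF : IsPosHomogeneous lam F) {ξ : E}
    (hd : DifferentiableAt ℝ F ξ) :
    fderiv ℝ F ξ ξ = lam • F ξ := by
  have h₁ : HasDerivAt (fun t : ℝ => F (t • ξ)) (fderiv ℝ F ξ ξ) 1 := by
    have hF' : HasFDerivAt F (fderiv ℝ F ξ) ((1 : ℝ) • ξ) := by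
      rw [one_smul]
      exact hd.hasFDerivAt
    have hs : HasDerivAt (fun t : ℝ => t • ξ) ξ 1 := by
      simpa using (hasDerivAt_id (1 : ℝ)).smul_const ξ
    exact hF'.comp_hasDerivAt 1 hs
  have h₂ : HasDerivAt (fun t : ℝ => t ^ lam • F ξ) (lam • F ξ) 1 := by
    simpa using (Real.hasDerivAt_rpow_const (p := lam) (.inl one_ne_zero)).smul_const (F ξ)
  refine h₁.unique (h₂.congr_of_eventuallyEq ?_)
  filter_upwards [lt_mem_nhds zero_lt_one] with t ht
  exact hF ht ξ

lemma IsPosHomogeneous.fderiv_fderiv_apply_self (hF : IsPosHomogeneous lam F) {ξ : E}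
    (hd : ContDiffAt ℝ 2 F ξ) (v : E) :
    fderiv ℝ (fderiv ℝ F) ξ ξ v = (lam - 1) • fderiv ℝ F ξ v := by
  rw [hF.fderiv_right.fderiv_apply_self
    ((hd.fderiv_right (m := 1) le_rfl).differentiableAt one_ne_zero), smul_apply]

end Homogeneous

namespace PseudoRiemannian

variable {ι E H M : Type*}
  [NormedAddCommGroup E] [NormedSpace ℝ E] [TopologicalSpace H] (I : ModelWithCorners ℝ E H)
  [TopologicalSpace M] [ChartedSpace H M]

lemma metricMatrix_inducedMetric [IsManifold I 1 M] [I.Boundaryless] {W : Type*}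
    [NormedAddCommGroup W] [NormedSpace ℝ W]
    (b : Module.Basis ι ℝ E) {j : M → W} (hj : MDifferentiable I 𝓘(ℝ, W) j) (B : W → W → ℝ)
    (x : M) {u : E} (hu : u ∈ (extChartAt I x).target) :
    metricMatrix I b (inducedMetric I j B) x u
      = Matrix.of fun i k => B (fderiv ℝ (j ∘ (extChartAt I x).symm) u (b i))
          (fderiv ℝ (j ∘ (extChartAt I x).symm) u (b k)) := by
  have hs : MDifferentiableAt 𝓘(ℝ, E) I (extChartAt I x).symm u :=
    ((contMDiffOn_extChartAt_symm (n := 1) x).mdifferentiableOn one_ne_zero).mdifferentiableAt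
      ((isOpen_extChartAt_target x).mem_nhds hu)
  have chain_rule (w : E) : mfderiv I 𝓘(ℝ, W) j ((extChartAt I x).symm u)
      (mfderiv 𝓘(ℝ, E) I (extChartAt I x).symm u w)
        = fderiv ℝ (j ∘ (extChartAt I x).symm) u w := by
    rw [← mfderiv_eq_fderiv, mfderiv_comp u (hj _) hs]
    rfl
  ext i k
  exact congrArg₂ B (chain_rule (b i)) (chain_rule (b k))

lemma partialDeriv_partialDeriv {Z : Type*} [NormedAddCommGroup Z] [NormedSpace ℝ Z]
    (b : Module.Basis ι ℝ E) (i j : ι) {F : E → Z} {u : E} (hF : ContDiffAt ℝ 2 F u) :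
    partialDeriv b i (partialDeriv b j F) u = fderiv ℝ (fderiv ℝ F) u (b i) (b j) :=
  fderiv_fderiv_apply hF (b i) (b j)

lemma partialDeriv_partialDeriv_comp_clm {W Z κ : Type*} [NormedAddCommGroup W] [NormedSpace ℝ W]
    [NormedAddCommGroup Z] [NormedSpace ℝ Z] {b : Module.Basis ι ℝ E} {b' : Module.Basis κ ℝ W}
    {T : E →L[ℝ] W} {i : ι} {k : κ} (hT : T (b i) = b' k) {F : W → Z} {u : E}
    (hF : ContDiffAt ℝ 2 F (T u)) :
    partialDeriv b i (partialDeriv b i (F ∘ T)) u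
      = partialDeriv b' k (partialDeriv b' k F) (T u) := by
  have hF₀ : ContDiffAt ℝ 2 F (T u + 0) := by rwa [add_zero]
  have h := fderiv_fderiv_comp_affine T 0 hF₀ (b i) (b i)
  simp only [add_zero] at h
  rw [partialDeriv_partialDeriv _ _ _ (hF.comp u T.contDiff.contDiffAt),
    partialDeriv_partialDeriv _ _ _ hF, ← hT]
  exact h

lemma differentiableAt_partialDeriv {Z : Type*} [NormedAddCommGroup Z] [NormedSpace ℝ Z]
    (b : Module.Basis ι ℝ E) (i : ι) {F : E → Z} {u : E} (hF : ContDiffAt ℝ 2 F u) :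
    DifferentiableAt ℝ (partialDeriv b i F) u :=
  ((hF.fderiv_right (m := 1) le_rfl).differentiableAt one_ne_zero).clm_apply
    (differentiableAt_const (b i))

lemma partialDeriv_comm {Z : Type*} [NormedAddCommGroup Z] [NormedSpace ℝ Z]
    (b : Module.Basis ι ℝ E) (i j : ι) {F : E → Z} {u : E} (hF : ContDiffAt ℝ 2 F u) :
    partialDeriv b i (partialDeriv b j F) u = partialDeriv b j (partialDeriv b i F) u := by
  rw [partialDeriv_partialDeriv b i j hF, partialDeriv_partialDeriv b j i hF]
  exact hF.isSymmSndFDerivAt (by simp) (b i) (b j)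

/-- The coordinates are stationary at `u` for the metric with components `G`: all first derivatives
of the components vanish at `u`. -/
def IsStationaryAt (G : E → Matrix ι ι ℝ) (u : E) : Prop :=
  ∀ i j, HasFDerivAt (fun v => G v i j) (0 : E →L[ℝ] ℝ) u

section Stationary

variable (b : Module.Basis ι ℝ E) {G : E → Matrix ι ι ℝ} {u : E}

lemma IsStationaryAt.partialDeriv_eq_zero (hG : IsStationaryAt G u) (m i j : ι) :
    partialDeriv b m (fun v => G v i j) u = 0 := by
  rw [partialDeriv, (hG i j).fderiv, zero_apply]

variable [Fintype ι] [DecidableEq ι]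

lemma IsStationaryAt.continuousAt_inv (hG : IsStationaryAt G u) (hdet : IsUnit (G u).det) :
    ContinuousAt (fun v => (G v)⁻¹) u := by
  have hcont : ContinuousAt G u :=
    continuousAt_pi.2 fun i => continuousAt_pi.2 fun j => (hG i j).continuousAt
  refine (continuousAt_matrix_inv (G u) ?_).comp hcont
  simpa using continuousAt_inv₀ hdet.ne_zero

lemma christoffel_of_isStationaryAt (hG : IsStationaryAt G u) (k i j : ι) :
    christoffel b G k i j u = 0 := by
  simp [christoffel, hG.partialDeriv_eq_zero b]

lemma partialDeriv_christoffel_of_isStationaryAt (hG : IsStationaryAt G u)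
    (hC : ∀ i j, ContDiffAt ℝ 2 (fun v => G v i j) u) (hdet : IsUnit (G u).det) (m k i j : ι) :
    partialDeriv b m (christoffel b G k i j) u
      = (1 / 2) * ∑ l, (G u)⁻¹ k l * (partialDeriv b m (partialDeriv b i fun v => G v j l) u
          + partialDeriv b m (partialDeriv b j fun v => G v i l) u
          - partialDeriv b m (partialDeriv b l fun v => G v i j) u) := by
  have hfirst (a c d : ι) : HasFDerivAt (partialDeriv b a fun v => G v c d) _ u :=
    (differentiableAt_partialDeriv b a (hC c d)).hasFDerivAt
  have hterm (l : ι) := hasFDerivAt_smul_of_eq_zero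
    (continuousAt_pi.1 (continuousAt_pi.1 (hG.continuousAt_inv hdet) k) l)
    (((hfirst i j l).add (hfirst j i l)).sub (hfirst l i j))
    (by simp [hG.partialDeriv_eq_zero b])
  have h := ((HasFDerivAt.fun_sum fun l (_ : l ∈ Finset.univ) => hterm l).const_mul (1 / 2)).fderiv
  exact (DFunLike.congr_fun h (b m)).trans (by simp [partialDeriv])

lemma ricci_of_isStationaryAt (hG : IsStationaryAt G u)
    (hC : ∀ i j, ContDiffAt ℝ 2 (fun v => G v i j) u) (hdet : IsUnit (G u).det) (j k : ι) :
    ricci b G j k u = (1 / 2) * ∑ i, ∑ l, (G u)⁻¹ i l *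
      (partialDeriv b i (partialDeriv b k fun v => G v j l) u
        + partialDeriv b j (partialDeriv b l fun v => G v i k) u
        - partialDeriv b i (partialDeriv b l fun v => G v j k) u
        - partialDeriv b j (partialDeriv b k fun v => G v i l) u) := by
  simp only [ricci, christoffel_of_isStationaryAt b hG, mul_zero, sub_zero, Finset.sum_const_zero,
    add_zero, partialDeriv_christoffel_of_isStationaryAt b hG hC hdet, ← mul_sub,
    ← Finset.sum_sub_distrib, ← Finset.mul_sum]
  congr 1
  refine Finset.sum_congr rfl fun i _ => Finset.sum_congr rfl fun l _ => ?_
  rw [partialDeriv_comm b i j (hC k l)]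
  ring

lemma sum_inv_mul_ricci_of_isStationaryAt (hG : IsStationaryAt G u)
    (hC : ∀ i j, ContDiffAt ℝ 2 (fun v => G v i j) u) (hdet : IsUnit (G u).det) :
    ∑ j, ∑ k, (G u)⁻¹ j k * ricci b G j k u = ∑ j, ∑ k, ∑ i, ∑ l, (G u)⁻¹ j k * (G u)⁻¹ i l
      * (partialDeriv b i (partialDeriv b k fun v => G v j l) u
        - partialDeriv b i (partialDeriv b l fun v => G v j k) u) := by
  let T (y z : ι × ι) : ℝ := (G u)⁻¹ y.1 y.2 * (G u)⁻¹ z.1 z.2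
    * (partialDeriv b z.1 (partialDeriv b y.2 fun v => G v y.1 z.2) u
      - partialDeriv b z.1 (partialDeriv b z.2 fun v => G v y.1 y.2) u)
  have hswap : ∑ y, ∑ z, T z y = ∑ y, ∑ z, T y z := Finset.sum_comm
  calc ∑ j, ∑ k, (G u)⁻¹ j k * ricci b G j k u = ∑ y, ∑ z, (T y z + T z y) / 2 := by
        simp only [ricci_of_isStationaryAt b hG hC hdet, Fintype.sum_prod_type, Finset.mul_sum, T]
        refine Finset.sum_congr rfl fun j _ => Finset.sum_congr rfl fun k _ =>
          Finset.sum_congr rfl fun i _ => Finset.sum_congr rfl fun l _ => ?_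
        ring
    _ = ∑ y, ∑ z, T y z := by
        simp only [← Finset.sum_div, Finset.sum_add_distrib, hswap, add_self_div_two]
    _ = _ := by simp only [Fintype.sum_prod_type, T]

lemma laplaceBeltrami_of_isStationaryAt (g : MetricField I M) (f : M → ℂ) (x : M)
    (hG : IsStationaryAt (metricMatrix I b g x) (extChartAt I x x)) :
    laplaceBeltrami I b g f x = ∑ i, ∑ j, (metricMatrix I b g x (extChartAt I x x))⁻¹ i j •
      partialDeriv b i (partialDeriv b j (f ∘ (extChartAt I x).symm)) (extChartAt I x x) := by
  simp only [laplaceBeltrami, christoffel_of_isStationaryAt b hG, zero_smul, Finset.sum_const_zero,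
    sub_zero]

end Stationary

section Diagonal

variable [DecidableEq ι] (b : Module.Basis ι ℝ E) {d : E → ι → ℝ} {u : E}

lemma isStationaryAt_diagonal (hd : ∀ i, HasFDerivAt (fun v => d v i) (0 : E →L[ℝ] ℝ) u) :
    IsStationaryAt (fun v => Matrix.diagonal (d v)) u := by
  intro i j
  rcases eq_or_ne i j with rfl | hij
  · simpa using hd i
  · simpa [Matrix.diagonal_apply_ne _ hij] using hasFDerivAt_const (0 : ℝ) u

lemma contDiffAt_diagonal_apply {n : WithTop ℕ∞} (hd : ∀ i, ContDiffAt ℝ n (fun v => d v i) u)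
    (i j : ι) : ContDiffAt ℝ n (fun v => Matrix.diagonal (d v) i j) u := by
  rcases eq_or_ne i j with rfl | hij
  · simpa using hd i
  · simpa [Matrix.diagonal_apply_ne _ hij] using contDiffAt_const

lemma partialDeriv_partialDeriv_diagonal (i j k l : ι) :
    partialDeriv b i (partialDeriv b j fun v => Matrix.diagonal (d v) k l) u
      = if k = l then partialDeriv b i (partialDeriv b j fun v => d v k) u else 0 := by
  split_ifs with h
  · simp [h]
  · have h₀ : partialDeriv b j (fun _ : E => (0 : ℝ)) = 0 := by
      funext v
      simp [partialDeriv]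
    simp [Matrix.diagonal_apply_ne _ h, h₀, partialDeriv]

variable [Fintype ι]

lemma inv_diagonal_apply {s : ι → ℝ} (hs : ∀ i, s i ≠ 0) (i j : ι) :
    (Matrix.diagonal s)⁻¹ i j = if i = j then (s i)⁻¹ else 0 := by
  have h : (Matrix.diagonal s)⁻¹ = Matrix.diagonal fun i => (s i)⁻¹ :=
    Matrix.inv_eq_right_inv (by simp [hs])
  rw [h, Matrix.diagonal_apply]

lemma sum_inv_mul_ricci_diagonal (hd₀ : ∀ i, d u i ≠ 0)
    (hd₁ : ∀ i, HasFDerivAt (fun v => d v i) (0 : E →L[ℝ] ℝ) u)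
    (hd₂ : ∀ i, ContDiffAt ℝ 2 (fun v => d v i) u) :
    ∑ j, ∑ k, (Matrix.diagonal (d u))⁻¹ j k * ricci b (fun v => Matrix.diagonal (d v)) j k u
      = -∑ i, ∑ j, if i = j then 0 else
        (d u i)⁻¹ * (d u j)⁻¹ * partialDeriv b i (partialDeriv b i fun v => d v j) u := by
  have hdet : IsUnit (Matrix.diagonal (d u)).det := by
    simp [Finset.prod_ne_zero_iff, hd₀]
  rw [sum_inv_mul_ricci_of_isStationaryAt b (isStationaryAt_diagonal hd₁)
    (contDiffAt_diagonal_apply hd₂) hdet]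
  simp only [inv_diagonal_apply hd₀, partialDeriv_partialDeriv_diagonal, ite_mul, mul_ite,
    zero_mul, mul_zero, Finset.sum_ite_eq, Finset.mem_univ, if_true]
  rw [Finset.sum_comm (f := fun i j => if i = j then _ else _)]
  simp only [← Finset.sum_neg_distrib]
  refine Finset.sum_congr rfl fun j _ => Finset.sum_comm.trans (Finset.sum_congr rfl fun i _ => ?_)
  simp only [Finset.sum_ite_eq, Finset.mem_univ, if_true]
  rcases eq_or_ne j i with rfl | hji
  · simp
  · simp only [hji, hji.symm, if_false]
    ring

lemma laplaceBeltrami_of_diagonal (g : MetricField I M) (f : M → ℂ) (x : M)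
    (hg : metricMatrix I b g x = fun v => Matrix.diagonal (d v))
    (hd₀ : ∀ i, d (extChartAt I x x) i ≠ 0)
    (hd₁ : ∀ i, HasFDerivAt (fun v => d v i) (0 : E →L[ℝ] ℝ) (extChartAt I x x)) :
    laplaceBeltrami I b g f x = ∑ i, (d (extChartAt I x x) i)⁻¹ •
      partialDeriv b i (partialDeriv b i (f ∘ (extChartAt I x).symm)) (extChartAt I x x) := by
  rw [laplaceBeltrami_of_isStationaryAt I b g f x (hg ▸ isStationaryAt_diagonal hd₁), hg]
  simp only [inv_diagonal_apply hd₀, ite_smul, zero_smul, Finset.sum_ite_eq, Finset.mem_univ,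
    if_true]

lemma scalarCurvature_of_diagonal (g : MetricField I M) (x : M)
    (hg : metricMatrix I b g x = fun v => Matrix.diagonal (d v))
    (hd₀ : ∀ i, d (extChartAt I x x) i ≠ 0)
    (hd₁ : ∀ i, HasFDerivAt (fun v => d v i) (0 : E →L[ℝ] ℝ) (extChartAt I x x))
    (hd₂ : ∀ i, ContDiffAt ℝ 2 (fun v => d v i) (extChartAt I x x)) :
    scalarCurvature I b g x = -∑ i, ∑ j, if i = j then 0 else
      (d (extChartAt I x x) i)⁻¹ * (d (extChartAt I x x) j)⁻¹
        * partialDeriv b i (partialDeriv b i fun v => d v j) (extChartAt I x x) := by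
  rw [scalarCurvature, hg, sum_inv_mul_ricci_diagonal b hd₀ hd₁ hd₂]

end Diagonal

end PseudoRiemannian

namespace IndefiniteOrthogonal

open PseudoRiemannian

section Stereographic

variable {E F : Type*} [NormedAddCommGroup E] [NormedAddCommGroup F]

/-- The conformal factor of the round metric of the unit sphere in the stereographic coordinates of
Mathlib, in which the tangent space at the centre is parametrized isometrically. -/
def conformalFactor (u : E) : ℝ := 16 * ((‖u‖ ^ 2 + 4)⁻¹) ^ 2

lemma conformalFactor_ne_zero (u : E) : conformalFactor u ≠ 0 := by
  unfold conformalFactor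
  positivity

lemma conformalFactor_zero : conformalFactor (0 : E) = 1 := by
  norm_num [conformalFactor]

variable [InnerProductSpace ℝ E] [InnerProductSpace ℝ F]

lemma contDiff_inv_norm_sq_add_four {n : WithTop ℕ∞} :
    ContDiff ℝ n fun u : E => (‖u‖ ^ 2 + 4)⁻¹ :=
  ((contDiff_norm_sq ℝ).add contDiff_const).inv fun u => by positivity

lemma hasFDerivAt_inv_norm_sq_add_four (u : E) :
    HasFDerivAt (fun v : E => (‖v‖ ^ 2 + 4)⁻¹) ((-2 * ((‖u‖ ^ 2 + 4)⁻¹) ^ 2) • innerSL ℝ u) u := by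
  have h₀ : ‖u‖ ^ 2 + 4 ≠ 0 := by positivity
  have h₁ : HasFDerivAt (fun v : E => ‖v‖ ^ 2 + 4) ((2 : ℝ) • innerSL ℝ u) u := by
    simpa [two_smul] using (hasStrictFDerivAt_norm_sq u).hasFDerivAt.add_const (4 : ℝ)
  refine ((hasDerivAt_inv h₀).comp_hasFDerivAt u h₁).congr_fderiv ?_
  rw [smul_smul, inv_pow]
  congr 1
  ring

lemma hasFDerivAt_inner_left (u w : E) :
    HasFDerivAt (fun v : E => inner ℝ v w) (innerSL ℝ w) u := by
  simp only [real_inner_comm w]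
  exact (innerSL ℝ w).hasFDerivAt

lemma contDiff_conformalFactor {n : WithTop ℕ∞} : ContDiff ℝ n (conformalFactor : E → ℝ) :=
  contDiff_const.mul (contDiff_inv_norm_sq_add_four.pow 2)

lemma fderiv_conformalFactor_apply (u w : E) : fderiv ℝ conformalFactor u w
    = (-4 * (‖u‖ ^ 2 + 4)⁻¹ * conformalFactor u) * inner ℝ u w := by
  rw [show fderiv ℝ conformalFactor u = _ from
    (((hasFDerivAt_inv_norm_sq_add_four u).pow 2).const_mul 16).fderiv]
  simp only [Nat.add_one_sub_one, pow_one, nsmul_eq_mul, Nat.cast_ofNat, smul_apply,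
    coe_innerSL_apply, smul_eq_mul, conformalFactor]
  ring

lemma hasFDerivAt_conformalFactor_zero : HasFDerivAt conformalFactor (0 : E →L[ℝ] ℝ) 0 := by
  have h₀ : fderiv ℝ conformalFactor (0 : E) = 0 := by
    ext w
    simp [fderiv_conformalFactor_apply]
  exact h₀ ▸ (contDiff_conformalFactor.differentiable one_ne_zero 0).hasFDerivAt

lemma fderiv_fderiv_conformalFactor_zero (v w : E) :
    fderiv ℝ (fderiv ℝ conformalFactor) 0 v w = -inner ℝ v w := by
  have hcont : Continuous fun u : E => -4 * (‖u‖ ^ 2 + 4)⁻¹ * conformalFactor u :=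
    ((contDiff_const.mul (contDiff_inv_norm_sq_add_four (n := 0))).mul
      contDiff_conformalFactor).continuous
  have h := (hasFDerivAt_smul_of_eq_zero hcont.continuousAt (hasFDerivAt_inner_left 0 w)
    (inner_zero_left w)).fderiv
  rw [← fderiv_fderiv_apply contDiff_conformalFactor.contDiffAt]
  simp only [fderiv_conformalFactor_apply]
  refine (DFunLike.congr_fun h v).trans ?_
  simp [conformalFactor_zero, real_inner_comm]

/-- The inverse of the stereographic projection of the unit sphere centred at `x`, precomposed with
an isometry `U` of the coordinate space onto the orthogonal complement of `x`. -/
def stereoParam (U : E →ₗᵢ[ℝ] F) (x : F) (u : E) : F :=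
  (4 * (‖u‖ ^ 2 + 4)⁻¹) • U u + (8 * (‖u‖ ^ 2 + 4)⁻¹ - 1) • x

variable (U : E →ₗᵢ[ℝ] F) (x : F)

lemma stereoParam_zero : stereoParam U x 0 = x := by
  norm_num [stereoParam]

lemma contDiff_stereoParam {n : WithTop ℕ∞} : ContDiff ℝ n (stereoParam U x) :=
  ((contDiff_const.mul contDiff_inv_norm_sq_add_four).smul U.contDiff).add
    (((contDiff_const.mul contDiff_inv_norm_sq_add_four).sub contDiff_const).smul contDiff_const)

lemma fderiv_stereoParam_apply (u w : E) : fderiv ℝ (stereoParam U x) u w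
    = (4 * (‖u‖ ^ 2 + 4)⁻¹) • U w
      + (-2 * ((‖u‖ ^ 2 + 4)⁻¹) ^ 2 * inner ℝ u w) • ((4 : ℝ) • U u + (8 : ℝ) • x) := by
  have hr := hasFDerivAt_inv_norm_sq_add_four u
  have h : HasFDerivAt (stereoParam U x) _ u :=
    ((hr.const_mul 4).smul U.toContinuousLinearMap.hasFDerivAt).add
      (((hr.const_mul 8).sub_const 1).smul_const x)
  rw [h.fderiv]
  simp only [LinearIsometry.coe_toContinuousLinearMap, add_apply, smul_apply,
    ContinuousLinearMap.smulRight_apply, coe_innerSL_apply, smul_eq_mul]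
  module

lemma fderiv_stereoParam_zero (w : E) : fderiv ℝ (stereoParam U x) 0 w = U w := by
  simp [fderiv_stereoParam_apply]

lemma inner_fderiv_stereoParam {U : E →ₗᵢ[ℝ] F} {x : F} (hx : ‖x‖ = 1)
    (hU : ∀ u, inner ℝ (U u) x = 0) (u v w : E) :
    inner ℝ (fderiv ℝ (stereoParam U x) u v) (fderiv ℝ (stereoParam U x) u w)
      = conformalFactor u * inner ℝ v w := by
  have hU' (a : E) : inner ℝ x (U a) = 0 := by rw [real_inner_comm, hU]
  have h₀ : ‖u‖ ^ 2 + 4 ≠ 0 := by positivity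
  simp only [fderiv_stereoParam_apply, inner_add_left, inner_add_right, real_inner_smul_left,
    real_inner_smul_right, hU, hU', U.inner_map_map, real_inner_self_eq_norm_sq, hx,
    real_inner_comm u v, conformalFactor]
  field_simp
  ring

lemma fderiv_fderiv_stereoParam_zero (v w : E) :
    fderiv ℝ (fderiv ℝ (stereoParam U x)) 0 v w = -(inner ℝ v w • x) := by
  have hr := hasFDerivAt_inv_norm_sq_add_four (0 : E)
  have hU := (U.toContinuousLinearMap.hasFDerivAt (x := 0)).const_smul (4 : ℝ)
  have h := (((hr.const_mul 4).smul_const (U w)).add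
    ((((hr.pow 2).const_mul (-2)).mul (hasFDerivAt_inner_left 0 w)).smul
      (hU.add_const ((8 : ℝ) • x)))).fderiv
  rw [← fderiv_fderiv_apply (contDiff_stereoParam U x).contDiffAt]
  simp only [fderiv_stereoParam_apply]
  refine (DFunLike.congr_fun h v).trans ?_
  simp only [norm_zero, map_zero, smul_zero, real_inner_comm, Pi.mul_apply, inner_zero_right,
    mul_zero, zero_smul, inner_zero_left, add_zero, LinearIsometry.coe_toContinuousLinearMap,
    Pi.smul_apply, add_apply, ContinuousLinearMap.smulRight_apply, smul_apply, coe_innerSL_apply,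
    zero_apply, smul_eq_mul]
  module

end Stereographic

section Sphere

lemma norm_coe_sphere {n : ℕ} (x : Sph n) : ‖(x : Euc n)‖ = 1 :=
  mem_sphere_zero_iff_norm.1 x.2

lemma inner_stdBasis {n : ℕ} (i j : Fin n) :
    inner ℝ (stdBasis n i) (stdBasis n j) = if i = j then 1 else 0 := by
  rw [stdBasis, OrthonormalBasis.coe_toBasis, OrthonormalBasis.inner_eq_ite]

variable {n : ℕ} [NeZero n]

/-- The isometry of `ℝⁿ⁻¹` onto the orthogonal complement of `x` underlying Mathlib's stereographic
chart of the sphere centred at `x`, which projects from `-x`. -/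
def sphereFrame (x : Sph n) : Euc (n - 1) →ₗᵢ[ℝ] Euc n :=
  (Submodule.subtypeₗᵢ (Submodule.span ℝ {((-x : Sph n) : Euc n)})ᗮ).comp
    (OrthonormalBasis.fromOrthogonalSpanSingleton (n - 1)
      (ne_zero_of_mem_unit_sphere (-x))).repr.symm.toLinearIsometry

lemma inner_sphereFrame (x : Sph n) (u : Euc (n - 1)) :
    inner ℝ (sphereFrame x u) (x : Euc n) = 0 := by
  have h : inner ℝ (sphereFrame x u) (-(x : Euc n)) = 0 :=
    Submodule.mem_orthogonal_singleton_iff_inner_left.1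
      ((OrthonormalBasis.fromOrthogonalSpanSingleton (n - 1)
        (ne_zero_of_mem_unit_sphere (-x))).repr.symm u).2
  rwa [inner_neg_right, neg_eq_zero] at h

lemma coe_comp_extChartAt_sphere_symm (x : Sph n) :
    ((↑) : Sph n → Euc n) ∘ (extChartAt (𝓡 (n - 1)) x).symm = stereoParam (sphereFrame x) x := by
  funext u
  have h : ((extChartAt (𝓡 (n - 1)) x).symm u : Euc n)
      = (‖sphereFrame x u‖ ^ 2 + 4)⁻¹ • (4 : ℝ) • sphereFrame x u
        + (‖sphereFrame x u‖ ^ 2 + 4)⁻¹ • (‖sphereFrame x u‖ ^ 2 - 4) • (-(x : Euc n)) :=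
    stereographic'_symm_apply (-x) u
  have hu : ‖u‖ ^ 2 + 4 ≠ 0 := by positivity
  rw [Function.comp_apply, h, (sphereFrame x).norm_map, stereoParam, smul_smul, smul_smul,
    smul_neg, ← neg_smul, mul_comm]
  congr 2
  field_simp
  ring

lemma extChartAt_sphere_target (x : Sph n) : (extChartAt (𝓡 (n - 1)) x).target = Set.univ := by
  have h : (chartAt (Euc (n - 1)) x).target = Set.univ := stereographic'_target (-x)
  simp [h]

lemma extChartAt_sphere_symm_zero (x : Sph n) : (extChartAt (𝓡 (n - 1)) x).symm 0 = x :=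
  Subtype.ext ((congrFun (coe_comp_extChartAt_sphere_symm x) 0).trans (stereoParam_zero _ _))

lemma extChartAt_sphere_self (x : Sph n) : extChartAt (𝓡 (n - 1)) x x = 0 := by
  have h := (extChartAt (𝓡 (n - 1)) x).right_inv (x := 0)
    (by rw [extChartAt_sphere_target]; trivial)
  rwa [extChartAt_sphere_symm_zero] at h

lemma metricMatrix_sphereMetric (x : Sph n) :
    metricMatrix (𝓡 (n - 1)) (stdBasis (n - 1)) (sphereMetric n) x
      = fun u => Matrix.diagonal fun _ => conformalFactor u := by
  funext u
  have hcoe : MDifferentiable (𝓡 (n - 1)) 𝓘(ℝ, Euc n) ((↑) : Sph n → Euc n) :=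
    (contMDiff_coe_sphere (m := 1)).mdifferentiable one_ne_zero
  rw [sphereMetric, metricMatrix_inducedMetric _ _ hcoe _ _
    (by rw [extChartAt_sphere_target]; trivial), coe_comp_extChartAt_sphere_symm]
  ext i k
  rw [Matrix.of_apply, inner_fderiv_stereoParam (norm_coe_sphere x) (inner_sphereFrame x),
    inner_stdBasis, mul_ite, mul_one, mul_zero, Matrix.diagonal_apply]

lemma sphereLaplacian_eq_sum (f : Sph n → ℂ) (x : Sph n) :
    sphereLaplacian n f x = ∑ i, partialDeriv (stdBasis (n - 1)) i
      (partialDeriv (stdBasis (n - 1)) i (f ∘ (extChartAt (𝓡 (n - 1)) x).symm)) 0 := by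
  rw [sphereLaplacian, laplaceBeltrami_of_diagonal (𝓡 (n - 1)) _ _ f x
    (metricMatrix_sphereMetric x) (fun _ => conformalFactor_ne_zero _)
    (fun _ => by rw [extChartAt_sphere_self]; exact hasFDerivAt_conformalFactor_zero),
    extChartAt_sphere_self]
  simp only [conformalFactor_zero, inv_one, one_smul]

lemma sum_sphereFrame {Z : Type*} [NormedAddCommGroup Z] [NormedSpace ℝ Z] (x : Sph n)
    (B : Euc n →L[ℝ] Euc n →L[ℝ] Z) :
    ∑ i, B (sphereFrame x (stdBasis (n - 1) i)) (sphereFrame x (stdBasis (n - 1) i)) + B x x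
      = ∑ i, B (stdBasis n i) (stdBasis n i) := by
  let w : Fin (n - 1) ⊕ Unit → Euc n :=
    Sum.elim (fun i => sphereFrame x (stdBasis (n - 1) i)) fun _ => x
  have hw : Orthonormal ℝ w := by
    rw [orthonormal_iff_ite]
    rintro (i | i) (j | j)
    · simp only [w, Sum.elim_inl, (sphereFrame x).inner_map_map, inner_stdBasis, Sum.inl.injEq]
    · exact inner_sphereFrame x _
    · exact (real_inner_comm _ _).trans (inner_sphereFrame x _)
    · simp [w]
  have hcard : Fintype.card (Fin (n - 1) ⊕ Unit) = Module.finrank ℝ (Euc n) := by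
    simp [(finrankFact n).out]
  have h := sum_bilin_orthonormalBasis (OrthonormalBasis.mk hw
    (hw.linearIndependent.span_eq_top_of_card_eq_finrank' hcard).ge)
    (EuclideanSpace.basisFun (Fin n) ℝ) B
  simpa [w] using h

lemma sphereLaplacian_restrict {F : Euc n → ℂ} (x : Sph n) (hF : ContDiffAt ℝ 2 F x) :
    sphereLaplacian n (fun y => F y) x
      = ∑ i, fderiv ℝ (fderiv ℝ F) x (stdBasis n i) (stdBasis n i)
        - fderiv ℝ (fderiv ℝ F) x x x - ((n : ℂ) - 1) * fderiv ℝ F x x := by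
  let σ := stereoParam (sphereFrame x) (x : Euc n)
  have hσ : ContDiff ℝ 2 σ := contDiff_stereoParam _ _
  have hσ₀ : σ 0 = x := stereoParam_zero _ _
  have hcoord : (fun y : Sph n => F y) ∘ (extChartAt (𝓡 (n - 1)) x).symm = F ∘ σ :=
    congrArg (F ∘ ·) (coe_comp_extChartAt_sphere_symm x)
  have hF' : ContDiffAt ℝ 2 F (σ 0) := by rwa [hσ₀]
  have hterm (i : Fin (n - 1)) :
      partialDeriv (stdBasis (n - 1)) i (partialDeriv (stdBasis (n - 1)) i (F ∘ σ)) 0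
        = fderiv ℝ (fderiv ℝ F) x (sphereFrame x (stdBasis (n - 1) i))
            (sphereFrame x (stdBasis (n - 1) i)) - fderiv ℝ F x x := by
    rw [partialDeriv_partialDeriv _ _ _ (hF'.comp 0 hσ.contDiffAt),
      fderiv_fderiv_comp hF' hσ.contDiffAt, hσ₀]
    simp [σ, fderiv_stereoParam_zero, fderiv_fderiv_stereoParam_zero, sub_eq_add_neg]
  have hn : ((n - 1 : ℕ) : ℂ) = (n : ℂ) - 1 := Nat.cast_pred (NeZero.pos n)
  rw [sphereLaplacian_eq_sum, hcoord, ← sum_sphereFrame x]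
  simp only [hterm, Finset.sum_sub_distrib, Finset.sum_const, Finset.card_univ, Fintype.card_fin,
    nsmul_eq_mul, hn]
  ring

lemma sphereLaplacian_restrict_affine {W : Type*} [NormedAddCommGroup W] [NormedSpace ℝ W]
    (T : Euc n →L[ℝ] W) (c : W) {F : W → ℂ} (x : Sph n) (hF : ContDiffAt ℝ 2 F (T x + c)) :
    sphereLaplacian n (fun y => F (T y + c)) x
      = ∑ i, fderiv ℝ (fderiv ℝ F) (T x + c) (T (stdBasis n i)) (T (stdBasis n i))
        - fderiv ℝ (fderiv ℝ F) (T x + c) (T x) (T x)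
        - ((n : ℂ) - 1) * fderiv ℝ F (T x + c) (T x) := by
  have hT : HasFDerivAt (fun y => T y + c) T (x : Euc n) := T.hasFDerivAt.add_const c
  have hfderiv : fderiv ℝ (fun y => F (T y + c)) x = (fderiv ℝ F (T x + c)).comp T :=
    ((hF.differentiableAt two_ne_zero).hasFDerivAt.comp (x : Euc n) hT).fderiv
  have hsmooth : ContDiffAt ℝ 2 (fun y => F (T y + c)) x :=
    hF.comp (x : Euc n) (T.contDiff.add contDiff_const).contDiffAt
  rw [sphereLaplacian_restrict x hsmooth, hfderiv]
  simp only [fderiv_fderiv_comp_affine T c hF, ContinuousLinearMap.comp_apply]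

end Sphere

section Product

variable {p q : ℕ}

/-- The coordinate basis of the model space of `S^{p-1} × S^{q-1}`. -/
abbrev prodBasis (p q : ℕ) :
    Module.Basis (Fin (p - 1) ⊕ Fin (q - 1)) ℝ (Euc (p - 1) × Euc (q - 1)) :=
  (stdBasis (p - 1)).prod (stdBasis (q - 1))

/-- The diagonal entries of the metric of `S^{p-1} × S^{q-1}` in stereographic coordinates. -/
def productDiag (u : Euc (p - 1) × Euc (q - 1)) : Fin (p - 1) ⊕ Fin (q - 1) → ℝ :=
  Sum.elim (fun _ => conformalFactor u.1) (fun _ => -conformalFactor u.2)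

lemma productDiag_ne_zero (u : Euc (p - 1) × Euc (q - 1)) (i : Fin (p - 1) ⊕ Fin (q - 1)) :
    productDiag u i ≠ 0 := by
  rcases i with _ | _
  · exact conformalFactor_ne_zero _
  · exact neg_ne_zero.2 (conformalFactor_ne_zero _)

lemma productDiag_zero_inl (i : Fin (p - 1)) :
    productDiag (0 : Euc (p - 1) × Euc (q - 1)) (.inl i) = 1 :=
  conformalFactor_zero

lemma productDiag_zero_inr (i : Fin (q - 1)) :
    productDiag (0 : Euc (p - 1) × Euc (q - 1)) (.inr i) = -1 :=
  congrArg Neg.neg conformalFactor_zero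

lemma contDiff_productDiag (i : Fin (p - 1) ⊕ Fin (q - 1)) {n : WithTop ℕ∞} :
    ContDiff ℝ n fun u : Euc (p - 1) × Euc (q - 1) => productDiag u i := by
  rcases i with _ | _
  · exact contDiff_conformalFactor.comp contDiff_fst
  · exact (contDiff_conformalFactor.comp contDiff_snd).neg

lemma hasFDerivAt_productDiag_zero (i : Fin (p - 1) ⊕ Fin (q - 1)) :
    HasFDerivAt (fun u : Euc (p - 1) × Euc (q - 1) => productDiag u i)
      (0 : Euc (p - 1) × Euc (q - 1) →L[ℝ] ℝ) 0 := by
  have h (m : ℕ) (T : Euc (p - 1) × Euc (q - 1) →L[ℝ] Euc m) :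
      HasFDerivAt (fun u => conformalFactor (T u)) (0 : Euc (p - 1) × Euc (q - 1) →L[ℝ] ℝ) 0 := by
    have h₀ : HasFDerivAt conformalFactor (0 : Euc m →L[ℝ] ℝ) (T 0) := by
      rw [map_zero]
      exact hasFDerivAt_conformalFactor_zero
    exact h₀.comp 0 T.hasFDerivAt
  rcases i with _ | _
  · exact h _ (.fst ℝ _ _)
  · exact (h _ (.snd ℝ _ _)).neg.congr_fderiv neg_zero

lemma fderiv_fderiv_productDiag_inl (v w : Euc (p - 1) × Euc (q - 1)) (j : Fin (p - 1)) :
    fderiv ℝ (fderiv ℝ fun u : Euc (p - 1) × Euc (q - 1) => productDiag u (.inl j)) 0 v w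
      = -inner ℝ v.1 w.1 := by
  have h := fderiv_fderiv_comp_affine (.fst ℝ (Euc (p - 1)) (Euc (q - 1))) 0 (u := 0)
    (F := conformalFactor) contDiff_conformalFactor.contDiffAt v w
  simp only [map_zero, add_zero, fderiv_fderiv_conformalFactor_zero] at h
  exact h

lemma fderiv_fderiv_productDiag_inr (v w : Euc (p - 1) × Euc (q - 1)) (j : Fin (q - 1)) :
    fderiv ℝ (fderiv ℝ fun u : Euc (p - 1) × Euc (q - 1) => productDiag u (.inr j)) 0 v w
      = inner ℝ v.2 w.2 := by
  have h := fderiv_fderiv_comp_affine (.snd ℝ (Euc (p - 1)) (Euc (q - 1))) 0 (u := 0)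
    (F := fun y => -conformalFactor y) contDiff_conformalFactor.neg.contDiffAt v w
  have hneg : fderiv ℝ (fun y : Euc (q - 1) => -conformalFactor y) = -fderiv ℝ conformalFactor :=
    funext fun _ => fderiv_fun_neg
  simp only [map_zero, add_zero, hneg, fderiv_neg, neg_apply, fderiv_fderiv_conformalFactor_zero,
    neg_neg] at h
  exact h

variable [NeZero p] [NeZero q] (z : Sph p × Sph q)

lemma extChartAt_product_self : extChartAt (model p q) z z = 0 := by
  rw [extChartAt_prod]
  exact Prod.ext (extChartAt_sphere_self z.1) (extChartAt_sphere_self z.2)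

lemma extChartAt_product_symm : ⇑(extChartAt (model p q) z).symm
    = Prod.map (extChartAt (𝓡 (p - 1)) z.1).symm (extChartAt (𝓡 (q - 1)) z.2).symm := by
  rw [extChartAt_prod]
  rfl

lemma extChartAt_product_target : (extChartAt (model p q) z).target = Set.univ := by
  rw [extChartAt_prod, PartialEquiv.prod_target, extChartAt_sphere_target,
    extChartAt_sphere_target, Set.univ_prod_univ]

lemma fderiv_coe_comp_extChartAt_product_symm (u v : Euc (p - 1) × Euc (q - 1)) :
    fderiv ℝ ((fun z : Sph p × Sph q => ((z.1 : Euc p), (z.2 : Euc q)))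
        ∘ (extChartAt (model p q) z).symm) u v
      = (fderiv ℝ (stereoParam (sphereFrame z.1) (z.1 : Euc p)) u.1 v.1,
          fderiv ℝ (stereoParam (sphereFrame z.2) (z.2 : Euc q)) u.2 v.2) := by
  have h : (fun z : Sph p × Sph q => ((z.1 : Euc p), (z.2 : Euc q)))
        ∘ (extChartAt (model p q) z).symm
      = Prod.map (stereoParam (sphereFrame z.1) (z.1 : Euc p))
          (stereoParam (sphereFrame z.2) (z.2 : Euc q)) := by
    rw [extChartAt_product_symm, ← coe_comp_extChartAt_sphere_symm,
      ← coe_comp_extChartAt_sphere_symm]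
    rfl
  have hd {n : ℕ} [NeZero n] (x : Sph n) (a : Euc (n - 1)) :
      HasFDerivAt (stereoParam (sphereFrame x) (x : Euc n)) _ a :=
    ((contDiff_stereoParam _ _).differentiable one_ne_zero a).hasFDerivAt
  rw [h, ((hd z.1 u.1).prodMap u (hd z.2 u.2)).fderiv]
  rfl

lemma contMDiff_coe_product {n : WithTop ℕ∞} : ContMDiff (model p q) 𝓘(ℝ, Euc p × Euc q) n
    fun z : Sph p × Sph q => ((z.1 : Euc p), (z.2 : Euc q)) :=
  (contMDiff_coe_sphere.comp contMDiff_fst).prodMk_space (contMDiff_coe_sphere.comp contMDiff_snd)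

lemma metricMatrix_productMetric : metricMatrix (model p q) (prodBasis p q) (productMetric p q) z
    = fun u => Matrix.diagonal (productDiag u) := by
  funext u
  rw [productMetric, metricMatrix_inducedMetric _ _
    (contMDiff_coe_product.mdifferentiable one_ne_zero) _ _
    (by rw [extChartAt_product_target]; trivial)]
  ext i k
  rw [Matrix.of_apply, form, fderiv_coe_comp_extChartAt_product_symm,
    fderiv_coe_comp_extChartAt_product_symm,
    inner_fderiv_stereoParam (norm_coe_sphere z.1) (inner_sphereFrame z.1),
    inner_fderiv_stereoParam (norm_coe_sphere z.2) (inner_sphereFrame z.2),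
    Matrix.diagonal_apply]
  rcases i with i | i <;> rcases k with k | k <;>
    simp only [Module.Basis.prod_apply, Sum.elim_inl, Sum.elim_inr, Function.comp_apply,
      LinearMap.inl_apply, LinearMap.inr_apply, inner_zero_left, inner_zero_right, inner_stdBasis,
      productDiag, Sum.inl.injEq, Sum.inr.injEq, reduceCtorEq, if_false, mul_ite, mul_one, mul_zero,
      sub_zero, zero_sub, neg_zero, apply_ite fun t : ℝ => -t]

lemma scalarCurvature_product :
    scalarCurvature (model p q) (prodBasis p q) (productMetric p q) z
      = ((p : ℝ) - 1) * (p - 2) - (q - 1) * (q - 2) := by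
  rw [scalarCurvature_of_diagonal (model p q) _ _ z (metricMatrix_productMetric z)
    (fun _ => productDiag_ne_zero _ _)
    (fun i => by rw [extChartAt_product_self]; exact hasFDerivAt_productDiag_zero i)
    (fun i => (contDiff_productDiag i).contDiffAt), extChartAt_product_self]
  have hp : ((p - 1 : ℕ) : ℝ) = p - 1 := Nat.cast_pred (NeZero.pos p)
  have hq : ((q - 1 : ℕ) : ℝ) = q - 1 := Nat.cast_pred (NeZero.pos q)
  have hsum {m : ℕ} (i : Fin m) (c : ℝ) : ∑ j, (if i = j then 0 else c) = (m - 1) * c := by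
    have h (j : Fin m) : (if i = j then 0 else c) = c - if i = j then c else 0 := by
      split_ifs <;> simp
    simp [h, sub_mul]
  simp only [partialDeriv_partialDeriv _ _ _ (contDiff_productDiag _).contDiffAt,
    Fintype.sum_sum_type, fderiv_fderiv_productDiag_inl, fderiv_fderiv_productDiag_inr,
    productDiag_zero_inl, productDiag_zero_inr]
  simp only [Module.Basis.prod_apply, Sum.elim_inl, Sum.elim_inr, Function.comp_apply,
    LinearMap.inl_apply, LinearMap.inr_apply, inner_zero_left, inner_stdBasis, if_true,
    Sum.inl.injEq, Sum.inr.injEq, reduceCtorEq, if_false, inv_one, inv_neg, hsum, neg_zero,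
    mul_zero, Finset.sum_const_zero, add_zero, zero_add, Finset.sum_const, Finset.card_univ,
    Fintype.card_fin, nsmul_eq_mul, hp, hq]
  ring

lemma laplaceBeltrami_product {f : Sph p × Sph q → ℂ} (hf : IsSmooth f) :
    laplaceBeltrami (model p q) (prodBasis p q) (productMetric p q) f z
      = sphereLaplacian p (fun x => f (x, z.2)) z.1
        - sphereLaplacian q (fun y => f (z.1, y)) z.2 := by
  let g := f ∘ (extChartAt (model p q) z).symm
  have hg : ContDiffAt ℝ 2 g 0 := by
    rw [← extChartAt_product_self z]
    exact contDiffAt_infty.1 (contDiffAt_coord (model p q) hf z) 2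
  have hfst : (fun x => f (x, z.2)) ∘ (extChartAt (𝓡 (p - 1)) z.1).symm
      = g ∘ ContinuousLinearMap.inl ℝ _ _ := by
    simp only [g, extChartAt_product_symm]
    funext u
    exact congrArg (fun y => f (_, y)) (extChartAt_sphere_symm_zero z.2).symm
  have hsnd : (fun y => f (z.1, y)) ∘ (extChartAt (𝓡 (q - 1)) z.2).symm
      = g ∘ ContinuousLinearMap.inr ℝ _ _ := by
    simp only [g, extChartAt_product_symm]
    funext u
    exact congrArg (fun x => f (x, _)) (extChartAt_sphere_symm_zero z.1).symm
  rw [laplaceBeltrami_of_diagonal (model p q) _ _ f z (metricMatrix_productMetric z)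
    (fun _ => productDiag_ne_zero _ _)
    (fun i => by rw [extChartAt_product_self]; exact hasFDerivAt_productDiag_zero i),
    extChartAt_product_self, sphereLaplacian_eq_sum, sphereLaplacian_eq_sum, hfst, hsnd,
    Fintype.sum_sum_type, sub_eq_add_neg, ← Finset.sum_neg_distrib]
  simp only [productDiag_zero_inl, productDiag_zero_inr, inv_one, one_smul, inv_neg, neg_smul]
  congr 1 <;> refine Finset.sum_congr rfl fun i _ => ?_
  · rw [partialDeriv_partialDeriv_comp_clm (b' := prodBasis p q) (k := .inl i) (by simp)
      (by rwa [map_zero]), map_zero]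
  · rw [partialDeriv_partialDeriv_comp_clm (b' := prodBasis p q) (k := .inr i) (by simp)
      (by rwa [map_zero]), map_zero]

theorem intrinsicYamabe_eq_yamabeOp (hpq : 4 ≤ p + q) {f : Sph p × Sph q → ℂ} (hf : IsSmooth f) :
    intrinsicYamabe p q f = yamabeOp p q f := by
  funext z
  have hp : ((p - 1 : ℕ) : ℝ) = p - 1 := Nat.cast_pred (NeZero.pos p)
  have hq : ((q - 1 : ℕ) : ℝ) = q - 1 := Nat.cast_pred (NeZero.pos q)
  have hn : (p : ℝ) - 1 + (q - 1) - 1 ≠ 0 := by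
    have : (4 : ℝ) ≤ p + q := by exact_mod_cast hpq
    linarith
  have hcurv : (((p - 1 + (q - 1) : ℕ) : ℝ) - 2) / (4 * (((p - 1 + (q - 1) : ℕ) : ℝ) - 1))
      * (((p : ℝ) - 1) * (p - 2) - (q - 1) * (q - 2))
      = (1 / 4) * ((p : ℝ) - 2) ^ 2 - (1 / 4) * ((q : ℝ) - 2) ^ 2 := by
    rw [Nat.cast_add, hp, hq]
    field_simp
    ring
  rw [intrinsicYamabe, yamabe, laplaceBeltrami_product z hf, scalarCurvature_product, yamabeOp,
    Fintype.card_sum, Fintype.card_fin, Fintype.card_fin, hcurv]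
  push_cast
  ring

end Product

section Action

variable {p q : ℕ}

/-- The coordinate basis of `ℝ^{p,q}`. -/
abbrev ambientBasis (p q : ℕ) : Module.Basis (Fin p ⊕ Fin q) ℝ (Euc p × Euc q) :=
  (stdBasis p).prod (stdBasis q)

lemma ambientBasis_repr (z : Euc p × Euc q) :
    ⇑((ambientBasis p q).repr z) = (Sum.elim z.1 z.2 : Fin p ⊕ Fin q → ℝ) := by
  funext k
  cases k <;> simp

/-- The action of an element of `O(p,q)` on `ℝ^{p,q}` as a continuous linear map. -/
def actCLM (h : O p q) : Euc p × Euc q →L[ℝ] Euc p × Euc q :=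
  (Matrix.toLin (ambientBasis p q) (ambientBasis p q)
    (h : GL (Fin p ⊕ Fin q) ℝ).val).toContinuousLinearMap

lemma actCLM_apply (h : O p q) (z : Euc p × Euc q) : actCLM h z = act h z := by
  refine (ambientBasis p q).repr.injective (DFunLike.coe_injective ?_)
  rw [ambientBasis_repr (act h z), elim_act, ← ambientBasis_repr z]
  simp [actCLM, ← LinearMap.toMatrix_mulVec_repr (ambientBasis p q) (ambientBasis p q)]

lemma act_one (z : Euc p × Euc q) : act 1 z = z := by
  simp [← actCLM_apply, actCLM]

lemma act_mul (h k : O p q) (z : Euc p × Euc q) : act (h * k) z = act h (act k z) := by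
  simp only [← actCLM_apply]
  exact Matrix.toLin_mul_apply _ _ _ _ _ z

lemma act_smul (h : O p q) (t : ℝ) (z : Euc p × Euc q) : act h (t • z) = t • act h z := by
  simp only [← actCLM_apply, map_smul]

lemma act_ambientBasis (h : O p q) (k : Fin p ⊕ Fin q) :
    actCLM h (ambientBasis p q k)
      = ∑ i, (h : GL (Fin p ⊕ Fin q) ℝ).val i k • ambientBasis p q i :=
  Matrix.toLin_self _ _ _ k

lemma Ipq_mul_Ipq : Ipq p q * Ipq p q = 1 := by
  rw [Ipq, Matrix.diagonal_mul_diagonal, ← Matrix.diagonal_one]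
  congr 1
  funext k
  cases k <;> simp

lemma mul_Ipq_mul_transpose (h : O p q) :
    (h : GL (Fin p ⊕ Fin q) ℝ).val * Ipq p q * (h : GL (Fin p ⊕ Fin q) ℝ).val.transpose
      = Ipq p q := by
  obtain ⟨⟨m, _, _, _⟩, hm : m.transpose * Ipq p q * m = Ipq p q⟩ := h
  have hleft : Ipq p q * m.transpose * Ipq p q * m = 1 := by
    rw [Matrix.mul_assoc (Ipq p q), Matrix.mul_assoc (Ipq p q), hm, Ipq_mul_Ipq]
  have hright : m * (Ipq p q * m.transpose * Ipq p q) = 1 := mul_eq_one_comm.1 hleft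
  calc m * Ipq p q * m.transpose
      = m * (Ipq p q * m.transpose * Ipq p q) * Ipq p q := by
        simp only [Matrix.mul_assoc, Ipq_mul_Ipq, Matrix.mul_one]
    _ = Ipq p q := by rw [hright, Matrix.one_mul]

end Action

section Box

variable {p q : ℕ} {Z : Type*} [NormedAddCommGroup Z] [NormedSpace ℝ Z]

/-- The signs of the metric `dx₁² + ⋯ + dx_p² - dy₁² - ⋯ - dy_q²`, so that `Ipq` is the diagonal
matrix of `signature`. -/
abbrev signature (p q : ℕ) : Fin p ⊕ Fin q → ℝ := Sum.elim (fun _ => 1) fun _ => -1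

/-- The ultrahyperbolic operator `∑ ∂²/∂xᵢ² - ∑ ∂²/∂yⱼ²` of `ℝ^{p,q}`. -/
def box (F : Euc p × Euc q → Z) (ξ : Euc p × Euc q) : Z :=
  ∑ k, signature p q k • fderiv ℝ (fderiv ℝ F) ξ (ambientBasis p q k) (ambientBasis p q k)

lemma box_eq_sum_sub_sum (F : Euc p × Euc q → Z) (ξ : Euc p × Euc q) :
    box F ξ = ∑ i, fderiv ℝ (fderiv ℝ F) ξ (stdBasis p i, 0) (stdBasis p i, 0)
      - ∑ j, fderiv ℝ (fderiv ℝ F) ξ (0, stdBasis q j) (0, stdBasis q j) := by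
  simp only [box, Fintype.sum_sum_type, Sum.elim_inl, Sum.elim_inr, one_smul, neg_one_smul,
    Finset.sum_neg_distrib, ← sub_eq_add_neg, Module.Basis.prod_apply, Function.comp_apply,
    LinearMap.inl_apply, LinearMap.inr_apply]

lemma box_comp_act (h : O p q) {F : Euc p × Euc q → Z} {ξ : Euc p × Euc q}
    (hF : ContDiffAt ℝ 2 F (act h ξ)) : box (fun η => F (act h η)) ξ = box F (act h ξ) := by
  simp only [← actCLM_apply] at hF ⊢
  have hcomp (v w : Euc p × Euc q) :
      fderiv ℝ (fderiv ℝ fun η => F (actCLM h η)) ξ v w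
        = fderiv ℝ (fderiv ℝ F) (actCLM h ξ) (actCLM h v) (actCLM h w) := by
    simpa using fderiv_fderiv_comp_affine (actCLM h) 0 (by simpa using hF) v w
  simp only [box, hcomp, act_ambientBasis]
  rw [sum_smul_bilin_sum, show Matrix.diagonal (signature p q) = Ipq p q from rfl,
    mul_Ipq_mul_transpose]
  simp only [Ipq, Matrix.diagonal_apply, ite_smul, zero_smul, Finset.sum_ite_eq,
    Finset.mem_univ, if_true]

lemma isPosHomogeneous_box {lam : ℝ} {F : Euc p × Euc q → Z} (hF : IsPosHomogeneous lam F) :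
    IsPosHomogeneous (lam - 2) (box F) := by
  intro t ht ξ
  have hdegree : lam - 1 - 1 = lam - 2 := by ring
  simp only [box, hF.fderiv_right.fderiv_right ht ξ, hdegree, smul_apply,
    smul_comm (signature p q _) (t ^ (lam - 2)), Finset.smul_sum]

/-- The degree of homogeneity of the extensions from `S^{p-1} × S^{q-1}` on which the
ultrahyperbolic operator acts as the Yamabe operator. -/
def weight (p q : ℕ) : ℝ := -(((p : ℝ) + (q : ℝ) - 4) / 2)

lemma yamabeOp_restrict [NeZero p] [NeZero q] {F : Euc p × Euc q → ℂ}
    (hF : IsPosHomogeneous (weight p q) F) (z : Sph p × Sph q)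
    (hd : ContDiffAt ℝ 2 F (incl z).1) :
    yamabeOp p q (fun z => F (incl z).1) z = box F (incl z).1 := by
  obtain ⟨x, y⟩ := z
  set X := ContinuousLinearMap.inl ℝ (Euc p) (Euc q)
  set Y := ContinuousLinearMap.inr ℝ (Euc p) (Euc q)
  have hXY (x : Sph p) (y : Sph q) : X x + Y y = (incl (x, y)).1 :=
    Prod.fst_add_snd (incl (x, y)).1
  have hYX (x : Sph p) (y : Sph q) : Y y + X x = (incl (x, y)).1 := (add_comm _ _).trans (hXY x y)
  have hx := sphereLaplacian_restrict_affine X (Y y) x (F := F) (by rwa [hXY])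
  have hy := sphereLaplacian_restrict_affine Y (X x) y (F := F) (by rwa [hYX])
  simp only [hXY, hYX] at hx hy
  set ζ := (incl (x, y)).1
  have hbox : box F ζ = ∑ i, fderiv ℝ (fderiv ℝ F) ζ (X (stdBasis p i)) (X (stdBasis p i))
      - ∑ j, fderiv ℝ (fderiv ℝ F) ζ (Y (stdBasis q j)) (Y (stdBasis q j)) :=
    box_eq_sum_sub_sum F ζ
  have hsymm : fderiv ℝ (fderiv ℝ F) ζ (X x) (Y y) = fderiv ℝ (fderiv ℝ F) ζ (Y y) (X x) :=
    (hd.isSymmSndFDerivAt (by simp)).eq _ _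
  have euler : fderiv ℝ F ζ (X x) + fderiv ℝ F ζ (Y y) = weight p q • F ζ := by
    rw [← map_add, hXY, hF.fderiv_apply_self (hd.differentiableAt two_ne_zero)]
  have euler' (w : Euc p × Euc q) :
      fderiv ℝ (fderiv ℝ F) ζ (X x) w + fderiv ℝ (fderiv ℝ F) ζ (Y y) w
        = (weight p q - 1) • fderiv ℝ F ζ w := by
    rw [← add_apply, ← map_add, hXY, hF.fderiv_fderiv_apply_self hd]
  have eulerX := euler' (X x)
  have eulerY := euler' (Y y)
  have hweight : (weight p q : ℂ) = -(((p : ℂ) + q - 4) / 2) := by simp [weight]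
  simp only [Complex.real_smul, Complex.ofReal_sub, Complex.ofReal_one, hweight]
    at euler eulerX eulerY
  simp only [yamabeOp, hx, hy, hbox]
  -- With `H = D²F ζ`, the radial second derivatives are `H(x, x) - H(y, y) = H(x + y, x - y)`.
  linear_combination eulerY - eulerX - hsymm - (((p : ℂ) - q) / 2) * euler

end Box

section Direction

variable {n : ℕ} [NeZero n]

open Classical in
/-- Radial projection of `Euc n` to the unit sphere, with a junk value at the origin. -/
def direction (x : Euc n) : Sph n :=
  if hx : x ≠ 0 then
    ⟨NormedSpace.normalize x,
      mem_sphere_zero_iff_norm.2 (NormedSpace.norm_normalize_eq_one_iff.2 hx)⟩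
  else ⟨EuclideanSpace.single 0 1, by simp⟩

lemma coe_direction {x : Euc n} (hx : x ≠ 0) : (direction x : Euc n) = NormedSpace.normalize x := by
  rw [direction, dif_pos hx]

lemma direction_smul {t : ℝ} (ht : 0 < t) (x : Euc n) : direction (t • x) = direction x := by
  by_cases hx : x = 0
  · rw [hx, smul_zero]
  · refine Subtype.ext ?_
    rw [coe_direction hx, coe_direction (smul_ne_zero ht.ne' hx),
      NormedSpace.normalize_smul_of_pos ht]

lemma direction_coe (x : Sph n) : direction (x : Euc n) = x :=
  Subtype.ext <| by
    rw [coe_direction (ne_zero_of_mem_unit_sphere x),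
      NormedSpace.normalize_eq_self_of_norm_eq_one (norm_coe_sphere x)]

lemma contMDiffAt_direction {x : Euc n} (hx : x ≠ 0) :
    ContMDiffAt 𝓘(ℝ, Euc n) (𝓡 (n - 1)) ∞ (direction : Euc n → Sph n) x := by
  let U : TopologicalSpace.Opens (Euc n) := ⟨{y | y ≠ 0}, isOpen_ne⟩
  have hnormalize (y : U) : ContDiffAt ℝ ∞ (fun y : Euc n => ‖y‖⁻¹ • y) y :=
    ((contDiffAt_id.norm ℝ y.2).inv (norm_ne_zero_iff.2 y.2)).smul contDiffAt_id
  have hcoe : ContMDiff 𝓘(ℝ, Euc n) 𝓘(ℝ, Euc n) ∞ fun y : U => (direction y.1 : Euc n) := by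
    simp only [fun y : U => coe_direction y.2]
    exact fun y => contMDiffAt_subtype_iff.2 (hnormalize y).contMDiffAt
  exact (contMDiffAt_subtype_iff (U := U) (x := ⟨x, hx⟩)).1
    (hcoe.codRestrict_sphere (fun y : U => (direction y.1).2) _)

end Direction

section Extension

variable {p q : ℕ}

lemma zero_lt_nu (ξ : cone p q) : 0 < nu ξ := (nu_pos ξ).1

lemma coe_eq_nu_smul_incl_Phi (ξ : cone p q) : ξ.1 = nu ξ • (incl (Phi ξ)).1 := by
  have hnu : nu ξ = ‖ξ.1.2‖ := ξ.2.1
  refine Prod.ext ?_ ?_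
  · exact (smul_inv_smul₀ (zero_lt_nu ξ).ne' _).symm
  · rw [hnu]
    exact (smul_inv_smul₀ (nu_pos ξ).2.ne' _).symm

variable [NeZero p] [NeZero q]

/-- The extension of a function on `S^{p-1} × S^{q-1}` to `ℝ^{p,q}` that is homogeneous of degree
`lam` and depends on the second factor through its direction only. -/
def homExt (lam : ℝ) (f : Sph p × Sph q → ℂ) (ξ : Euc p × Euc q) : ℂ :=
  ‖ξ.1‖ ^ lam • f (direction ξ.1, direction ξ.2)

lemma isPosHomogeneous_homExt (lam : ℝ) (f : Sph p × Sph q → ℂ) :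
    IsPosHomogeneous lam (homExt lam f) := by
  intro t ht ξ
  simp only [homExt, Prod.smul_fst, Prod.smul_snd, direction_smul ht, norm_smul,
    Real.norm_of_nonneg ht.le, Real.mul_rpow ht.le (norm_nonneg _), mul_smul]

lemma homExt_incl (lam : ℝ) (f : Sph p × Sph q → ℂ) (z : Sph p × Sph q) :
    homExt lam f (incl z).1 = f z := by
  simp only [homExt, incl, direction_coe, norm_coe_sphere, Real.one_rpow, one_smul]

lemma homExt_coe (lam : ℝ) (f : Sph p × Sph q → ℂ) (ξ : cone p q) :
    homExt lam f ξ.1 = nu ξ ^ lam • f (Phi ξ) := by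
  conv_lhs => rw [coe_eq_nu_smul_incl_Phi ξ, isPosHomogeneous_homExt lam f (zero_lt_nu ξ),
    homExt_incl]

lemma contDiffAt_homExt (lam : ℝ) {f : Sph p × Sph q → ℂ} (hf : IsSmooth f) (ξ : cone p q) :
    ContDiffAt ℝ ∞ (homExt lam f) ξ.1 := by
  have hx : ξ.1.1 ≠ 0 := norm_pos_iff.1 (nu_pos ξ).1
  have hy : ξ.1.2 ≠ 0 := norm_pos_iff.1 (nu_pos ξ).2
  have hdir : ContMDiffAt 𝓘(ℝ, Euc p × Euc q) (model p q) ∞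
      (fun η : Euc p × Euc q => (direction η.1, direction η.2)) ξ.1 :=
    ((contMDiffAt_direction hx).comp ξ.1 contDiff_fst.contMDiff.contMDiffAt).prodMk
      ((contMDiffAt_direction hy).comp ξ.1 contDiff_snd.contMDiff.contMDiffAt)
  have hnorm : ContDiffAt ℝ ∞ (fun η : Euc p × Euc q => ‖η.1‖ ^ lam) ξ.1 :=
    (contDiffAt_fst.norm ℝ hx).rpow_const_of_ne (norm_ne_zero_iff.2 hx)
  exact hnorm.smul (hf.contMDiffAt.comp ξ.1 hdir).contDiffAt

lemma yamabeOp_eq_box {f : Sph p × Sph q → ℂ} (hf : IsSmooth f) (z : Sph p × Sph q) :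
    yamabeOp p q f z = box (homExt (weight p q) f) (incl z).1 := by
  rw [← yamabeOp_restrict (isPosHomogeneous_homExt _ f) z
    (contDiffAt_infty.1 (contDiffAt_homExt _ hf (incl z)) 2)]
  simp only [homExt_incl]

end Extension

section Representation

variable {p q : ℕ}

/-- The pullback of `f` by `L h`, multiplied by `ν(h · z)` to the power `lam`; the paper's
`ϖ(h⁻¹) f` is the case `lam = weight p q`. -/
def twist (lam : ℝ) (h : O p q) (f : Sph p × Sph q → ℂ) (z : Sph p × Sph q) : ℂ :=
  nu (actCone h (incl z)) ^ lam • f (L h z)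

variable [NeZero p] [NeZero q]

lemma twist_eq_homExt (lam : ℝ) (h : O p q) (f : Sph p × Sph q → ℂ) (z : Sph p × Sph q) :
    twist lam h f z = homExt lam f (act h (incl z).1) :=
  (homExt_coe lam f (actCone h (incl z))).symm

lemma homExt_twist (lam : ℝ) (h : O p q) (f : Sph p × Sph q → ℂ) (ξ : cone p q) :
    homExt lam (twist lam h f) ξ.1 = homExt lam f (act h ξ.1) := by
  rw [homExt_coe, twist_eq_homExt, ← isPosHomogeneous_homExt lam f (zero_lt_nu ξ), ← act_smul]
  exact congrArg (fun η => homExt lam f (act h η)) (coe_eq_nu_smul_incl_Phi ξ).symm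

lemma twist_one (lam : ℝ) (f : Sph p × Sph q → ℂ) : twist lam 1 f = f := by
  funext z
  rw [twist_eq_homExt, act_one, homExt_incl]

lemma twist_mul (lam : ℝ) (h k : O p q) (f : Sph p × Sph q → ℂ) :
    twist lam (h * k) f = twist lam k (twist lam h f) := by
  funext z
  rw [twist_eq_homExt, twist_eq_homExt, act_mul]
  exact (homExt_twist lam h f (actCone k (incl z))).symm

lemma isSmooth_twist (lam : ℝ) (h : O p q) {f : Sph p × Sph q → ℂ} (hf : IsSmooth f) :
    IsSmooth (twist lam h f) := by
  rw [funext (twist_eq_homExt lam h f)]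
  intro z
  have hact : ContDiffAt ℝ ∞ (fun ξ => homExt lam f (actCLM h ξ)) (incl z).1 :=
    (contDiffAt_homExt lam hf (actCone h (incl z))).comp (incl z).1
      (actCLM h).contDiff.contDiffAt
  exact hact.contMDiffAt.comp z contMDiff_coe_product.contMDiffAt

lemma yamabeOp_twist (h : O p q) {f : Sph p × Sph q → ℂ} (hf : IsSmooth f)
    (z : Sph p × Sph q) : yamabeOp p q (twist (weight p q) h f) z
      = nu (actCone h (incl z)) ^ (weight p q - 2) • yamabeOp p q f (L h z) := by
  set F := homExt (weight p q) f
  have hF : IsPosHomogeneous (weight p q) F := isPosHomogeneous_homExt _ f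
  have hFh : IsPosHomogeneous (weight p q) fun ξ => F (act h ξ) := fun t ht ξ =>
    (congrArg F (act_smul h t ξ)).trans (hF ht _)
  have hd : ContDiffAt ℝ 2 F (act h (incl z).1) :=
    contDiffAt_infty.1 (contDiffAt_homExt _ hf (actCone h (incl z))) 2
  have hact : ContDiffAt ℝ 2 (act h) (incl z).1 := (actCLM h).contDiff.contDiffAt
  calc yamabeOp p q (twist (weight p q) h f) z
      = yamabeOp p q (fun z => F (act h (incl z).1)) z := by
        rw [funext (twist_eq_homExt _ h f)]
    _ = box (fun ξ => F (act h ξ)) (incl z).1 := yamabeOp_restrict hFh z (hd.comp _ hact)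
    _ = box F (act h (incl z).1) := box_comp_act h hd
    _ = box F (nu (actCone h (incl z)) • (incl (L h z)).1) :=
        congrArg (box F) (coe_eq_nu_smul_incl_Phi (actCone h (incl z)))
    _ = nu (actCone h (incl z)) ^ (weight p q - 2) • box F (incl (L h z)).1 :=
        isPosHomogeneous_box hF (zero_lt_nu _) _
    _ = nu (actCone h (incl z)) ^ (weight p q - 2) • yamabeOp p q f (L h z) := by
        rw [yamabeOp_eq_box hf]

lemma twist_mem_V (h : O p q) {f : Sph p × Sph q → ℂ} (hf : f ∈ V p q) :
    twist (weight p q) h f ∈ V p q :=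
  ⟨isSmooth_twist _ h hf.1, fun z => by rw [yamabeOp_twist h hf.1, hf.2, smul_zero]⟩

/-- The representation `ϖ^{p,q}` of `O(p,q)` on `V^{p,q}`. -/
def varpi (p q : ℕ) [NeZero p] [NeZero q] : Representation ℂ (O p q) (V p q) where
  toFun g :=
    { toFun := fun f => ⟨twist (weight p q) g⁻¹ f, twist_mem_V g⁻¹ f.2⟩
      map_add' := fun _ _ => Subtype.ext (funext fun _ => smul_add _ _ _)
      map_smul' := fun c _ => Subtype.ext (funext fun _ => smul_comm _ c _) }
  map_one' := LinearMap.ext fun f => Subtype.ext <| by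
    change twist (weight p q) 1⁻¹ f.1 = f.1
    rw [inv_one, twist_one]
  map_mul' g₁ g₂ := LinearMap.ext fun f => Subtype.ext <| by
    change twist (weight p q) (g₁ * g₂)⁻¹ f.1
      = twist (weight p q) g₁⁻¹ (twist (weight p q) g₂⁻¹ f.1)
    rw [mul_inv_rev, twist_mul]

lemma varpi_inv_apply (h : O p q) (f : V p q) (z : Sph p × Sph q) :
    (varpi p q h⁻¹ f).1 z = ((nu (actCone h (incl z)) ^ weight p q : ℝ) : ℂ) * f.1 (L h z) := by
  change twist (weight p q) h⁻¹⁻¹ f.1 z = _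
  rw [inv_inv, twist, Complex.real_smul]

end Representation

end IndefiniteOrthogonal

end

theorem theorem3p4p2 (p q : ℕ) [NeZero p] [NeZero q] :
    (∃ ρ : Representation ℂ (IndefiniteOrthogonal.O p q) (IndefiniteOrthogonal.V p q),
      ∀ (h : IndefiniteOrthogonal.O p q) (f : IndefiniteOrthogonal.V p q)
        (z : IndefiniteOrthogonal.Sph p × IndefiniteOrthogonal.Sph q),
        (ρ h⁻¹ f : IndefiniteOrthogonal.Sph p × IndefiniteOrthogonal.Sph q → ℂ) z
          = ((IndefiniteOrthogonal.nu
                (IndefiniteOrthogonal.actCone h (IndefiniteOrthogonal.incl z))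
              ^ (-(((p : ℝ) + (q : ℝ) - 4) / 2)) : ℝ) : ℂ)
            * (f : IndefiniteOrthogonal.Sph p × IndefiniteOrthogonal.Sph q → ℂ)
                (IndefiniteOrthogonal.L h z)) ∧
    (4 ≤ p + q →
      ∀ f : IndefiniteOrthogonal.Sph p × IndefiniteOrthogonal.Sph q → ℂ,
        IndefiniteOrthogonal.IsSmooth f →
          IndefiniteOrthogonal.intrinsicYamabe p q f = IndefiniteOrthogonal.yamabeOp p q f) :=
  ⟨⟨IndefiniteOrthogonal.varpi p q, IndefiniteOrthogonal.varpi_inv_apply⟩,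
    fun hpq _ hf => IndefiniteOrthogonal.intrinsicYamabe_eq_yamabeOp hpq hf⟩
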